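/- Let $d\ge 1$, $m\ge 2$, let $\Omega\subset\mathbb R^d$ be a bounded domain of class $C^1$ with outward unit normal $\eta$, and let $a,b>0$ satisfy $2b\cos\frac{\pi}{m+1}<a$. Put $\bar\lambda_\ell=a+2b\cos\frac{(m+1-\ell)\pi}{m+1}$ for $\ell=1,\dots,m$. Let $\rho_1,\dots,\rho_m\ge 0$ and let either $0<\alpha<1$, or $\alpha=0$ and all $\rho_\ell=0$, or $\alpha=1$ and all $\rho_\ell=0$. Let $D\subseteq\mathbb R^m$ be closed and convex with $[0,\infty)^m\subseteq D$ (for instance $D=[0,\infty)^m$ or $D=\mathbb R^m$), and let $F=(F_1,\dots,F_m):D\to\mathbb R^m$ be of class $C^1$ and such that: (A1) $F_\ell(W)\ge 0$ for every $\ell$ and every $W\in[0,\infty)^m$ with $W_\ell=0$; (A2) there are $C_1>0$ and an integer $N\ge 1$ with $|F_\ell(W)|\le C_1\bigl(1+\sum_{k=1}^m W_k\bigr)^N$ for all $\ell$ and all $W\in(0,\infty)^m$; (A3) there are constants $\overline D_\ell>0$ such that for all constants $D_\ell\ge\overline D_\ell$ there is $C_2>0$ with $\sum_{\ell=1}^{m-1}D_\ell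 F_\ell(W)+F_m(W)\le C_2\bigl(1+\sum_{k=1}^m W_k\bigr)$ for all $W\in[0,\infty)^m$. Let $w^0=(w^0_1,\dots,w^0_m)\in L^\infty(\Omega)^m$ be nonnegative almost everywhere, let $T_{\max}\in(0,\infty]$, and let $w=(w_1,\dots,w_m)$ be a classical solution with values in $D$ of $$\partial_t w_\ell-\bar\lambda_\ell\Delta w_\ell=F_\ell(w)\ \text{ in }(0,T_{\max})\times\Omega,\qquad \alpha w_\ell+(1-\alpha)\partial_\eta w_\ell=\rho_\ell\ \text{ on }(0,T_{\max})\times\partial\Omega,\qquad w_\ell(0,\cdot)=w^0_\ell ,$$ $\ell=1,\dots,m$. Here classical means: the partial derivatives $\partial_t w$ and $\partial_x^\beta w$, $|\beta|\le 2$, are continuous in $(0,T_{\max})\times\Omega$; $w$ and $\nabla w$ extend continuously to $(0,T_{\max})\times\overline\Omega$; $w$ is bounded on $(0,T']\times\Omega$ for every $T'<T_{\max}$; and $w(t,\cdot)\to w^0$ in $L^1(\Omega)$ as $t\to0^+$. Then for every real $T^*>0$ with $T^*\le T_{\max}$, every $p\in[1,\infty)$ and every $\ell=1,\dots,m$, $$w_\ell\in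 L^\infty\bigl(0,T^*;L^p(\Omega)\bigr).$$ -/

import Mathlib

open MeasureTheory Filter Topology Set
open scoped ENNReal

noncomputable section

namespace TridiagRD

/-- The Euclidean space `ℝ^d`. -/
abbrev Space (d : ℕ) : Type := EuclideanSpace ℝ (Fin d)

/-- `φ` is a `C¹` local defining function of `Ω` at `x`: near `x` the set `Ω` is `{φ < 0}`,
and the gradient of `φ` at `x` does not vanish. -/
def IsLocalDefiningFunction {d : ℕ} (Ω : Set (Space d)) (x : Space d) (φ : Space d → ℝ) : Prop :=
  ContDiffAt ℝ 1 φ x ∧ gradient φ x ≠ 0 ∧ ∀ᶠ y in 𝓝 x, (y ∈ Ω ↔ φ y < 0)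

/-- A bounded domain of class `C¹`. -/
structure IsBoundedC1Domain {d : ℕ} (Ω : Set (Space d)) : Prop where
  isOpen : IsOpen Ω
  isConnected : IsConnected Ω
  isBounded : Bornology.IsBounded Ω
  boundary : ∀ x ∈ frontier Ω, ∃ φ, IsLocalDefiningFunction Ω x φ

/-- `η` is the outward unit normal to `Ω` at the boundary point `x`. -/
def IsOutwardUnitNormal {d : ℕ} (Ω : Set (Space d)) (x η : Space d) : Prop :=
  ∃ φ, IsLocalDefiningFunction Ω x φ ∧ η = ‖gradient φ x‖⁻¹ • gradient φ x

/-- The eigenvalues, in ascending order, of the `m × m` tridiagonal Toeplitz matrix with `a` on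
the diagonal and `b` next to it. The index `ℓ : Fin m` counts from `0`, so that this is
`a + 2 b cos ((m + 1 - (ℓ + 1)) π / (m + 1))`. -/
def diffusionEigenvalue (m : ℕ) (a b : ℝ) (ℓ : Fin m) : ℝ :=
  a + 2 * b * Real.cos (((m : ℝ) - (ℓ : ℝ)) * Real.pi / ((m : ℝ) + 1))

/-- The closed nonnegative orthant of `ℝ^m`. -/
def orthant (m : ℕ) : Set (Fin m → ℝ) := {W | ∀ ℓ, 0 ≤ W ℓ}

/-- Quasipositivity: `F_ℓ(W) ≥ 0` whenever `W ≥ 0` and `W_ℓ = 0`. -/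
def Quasipositive {m : ℕ} (F : (Fin m → ℝ) → Fin m → ℝ) : Prop :=
  ∀ ℓ, ∀ W ∈ orthant m, W ℓ = 0 → 0 ≤ F W ℓ

/-- Polynomial growth on the open positive orthant. -/
def PolynomialGrowth {m : ℕ} (F : (Fin m → ℝ) → Fin m → ℝ) : Prop :=
  ∃ C > (0 : ℝ), ∃ N : ℕ, 1 ≤ N ∧ ∀ ℓ, ∀ W : Fin m → ℝ, (∀ k, 0 < W k) →
    |F W ℓ| ≤ C * (1 + ∑ k, W k) ^ N

/-- For all sufficiently large coefficients `D_1, …, D_{m-1}`, the combination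
`D_1 F_1 + ⋯ + D_{m-1} F_{m-1} + F_m` grows at most linearly on the orthant. The coefficient of
the last component is `1`; the constant may depend on the coefficients. -/
def LinearControl {m : ℕ} (F : (Fin m → ℝ) → Fin m → ℝ) : Prop :=
  ∃ Dbar : Fin m → ℝ, (∀ ℓ, 0 < Dbar ℓ) ∧
    ∀ D : Fin m → ℝ, (∀ ℓ, Dbar ℓ ≤ D ℓ) →
      ∃ C > (0 : ℝ), ∀ W ∈ orthant m,
        ∑ ℓ : Fin m, (if (ℓ : ℕ) + 1 = m then 1 else D ℓ) * F W ℓ ≤ C * (1 + ∑ k, W k)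

/-- The time interval `(0, T)`, `T ∈ (0, ∞]`. -/
def timeInterval (T : EReal) : Set ℝ := {t | 0 < t ∧ (t : EReal) < T}

/-- `w` is a classical solution on `(0, T) × Ω` of the diagonal reaction-diffusion system
`∂ₜ w_ℓ - lam_ℓ Δ w_ℓ = F_ℓ(w)` with boundary conditions
`α w_ℓ + (1 - α) ∂_η w_ℓ = ρ_ℓ` on `∂Ω` and initial value `w0`.
The set `D` is the domain of the reaction terms. -/
structure IsClassicalSolution {d m : ℕ} (Ω : Set (Space d)) (lam : Fin m → ℝ)
    (D : Set (Fin m → ℝ)) (F : (Fin m → ℝ) → Fin m → ℝ) (α : ℝ) (ρ : Fin m → ℝ)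
    (w0 : Space d → Fin m → ℝ) (T : EReal) (w : ℝ → Space d → Fin m → ℝ) : Prop where
  /-- The values lie in the domain of the reaction terms. -/
  mem_domain : ∀ t ∈ timeInterval T, ∀ x ∈ Ω, w t x ∈ D
  /-- Continuity up to the boundary. -/
  continuousOn : ContinuousOn (fun q : ℝ × Space d => w q.1 q.2) (timeInterval T ×ˢ closure Ω)
  /-- Second order differentiability in space, with jointly continuous second derivatives. -/
  contDiffOn : ∀ t ∈ timeInterval T, ∀ ℓ, ContDiffOn ℝ 2 (fun x => w t x ℓ) Ω
  continuousOn_hessian : ∀ ℓ, ContinuousOn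
    (fun q : ℝ × Space d => iteratedFDeriv ℝ 2 (fun x => w q.1 x ℓ) q.2) (timeInterval T ×ˢ Ω)
  /-- The equations. -/
  equation : ∀ t ∈ timeInterval T, ∀ x ∈ Ω, ∀ ℓ,
    HasDerivAt (fun s => w s x ℓ)
      (lam ℓ * Laplacian.laplacian (fun y => w t y ℓ) x + F (w t x) ℓ) t
  /-- The spatial gradient extends continuously up to the boundary, and its boundary values
  satisfy the boundary conditions. -/
  boundary : ∃ G : ℝ → Space d → Fin m → Space d,
    (∀ ℓ, ContinuousOn (fun q : ℝ × Space d => G q.1 q.2 ℓ) (timeInterval T ×ˢ closure Ω)) ∧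
    (∀ t ∈ timeInterval T, ∀ x ∈ Ω, ∀ ℓ, HasGradientAt (fun y => w t y ℓ) (G t x ℓ) x) ∧
    (∀ t ∈ timeInterval T, ∀ x ∈ frontier Ω, ∀ η, IsOutwardUnitNormal Ω x η → ∀ ℓ,
      α * w t x ℓ + (1 - α) * inner ℝ (G t x ℓ) η = ρ ℓ)
  /-- Bounded on `(0, T'] × Ω` for every `T' < T` (but not necessarily on `(0, T) × Ω`). -/
  locallyBounded : ∀ T' : ℝ, (T' : EReal) < T →
    ∃ M : ℝ, ∀ t, 0 < t → t ≤ T' → ∀ x ∈ Ω, ∀ ℓ, |w t x ℓ| ≤ M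
  /-- The initial value is attained in `L¹(Ω)` (hence, by boundedness, in every `L^q(Ω)`,
  `q < ∞`). -/
  initial : ∀ ℓ, Tendsto
    (fun t => eLpNorm (fun x => w t x ℓ - w0 x ℓ) 1 (volume.restrict Ω)) (𝓝[>] 0) (𝓝 0)

/-- `u` belongs to the Bochner space `L^∞(0, T; L^p(Ω))`. -/
def MemLinftyLp {d : ℕ} (T : ℝ) (Ω : Set (Space d)) (p : ℝ≥0∞) [Fact (1 ≤ p)]
    (u : ℝ → Space d → ℝ) : Prop :=
  ∃ v : ℝ → Lp ℝ p (volume.restrict Ω),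
    MemLp v ∞ (volume.restrict (Ioo 0 T)) ∧
    ∀ᵐ t ∂(volume.restrict (Ioo 0 T)), v t =ᵐ[volume.restrict Ω] u t

end TridiagRD

end

/-! The proof is a Lyapunov argument. Once `w ≥ 0`, it suffices to bound `∫ (Σ w_ℓ)^n` for all large
`n`, uniformly on `(0, T*)`. The power `(Σ W_ℓ)^n` is the sum of all words of length `n` in the
letters `W_1, …, W_m`; `lyap` weights each word by `∏ θ_i ^ (c_i²)`, where `c_i` counts the letter
`i`. The integral of this polynomial satisfies a linear differential inequality, for three reasons.

Diffusion: `∂_j` turns `lyap` of degree `n + 1` into `n + 1` times `lyap` of degree `n` with the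
index shifted by `e_j`. Since the exponents are squares, two shifts multiply a weight by `θ_i ^ (2
β_i + 1) θ_j ^ (2 β_j + 1)`, and by a further `θ_i ^ 2` if `i = j`. Hence every coefficient of the
Hessian form, weighted by the diffusion coefficients, is the same quadratic form after rescaling the
variables. Taking `θ = 1` for the last letter and `θ = Θ` large for the others makes it nonnegative
(`exists_weight_quadratic`, `lyap_quadratic_nonneg`). The eigenvalues enter only through their
positivity.

Reaction: one shift by `e_j` gives the factor `θ_j ^ (2 β_j + 1)`, which is `1` for the last
component and at least `Θ` otherwise. Each coefficient of `∇H · F` is therefore a combination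
covered by linear control (`exists_lyap_reaction_le`).

Boundary: the flux is bounded above, because in the Robin case the absorbing term `-α w` has one
degree more than the inhomogeneity (`exists_lyap_boundary_le`).

Integration by parts on the `C¹` domain is carried out with cutoff functions: a one-sided bound on
the normal component of a field controls the collar terms, as the collar has volume `O(ε)` and the
cutoff has slope `O(1/ε)` (`exists_cutoff`). The resulting energy inequality
`exists_integral_le_gronwallBound` is used twice: for the cubes of the negative parts, which gives
`w ≥ 0`, and for `lyap`, which gives the moments. Its constants do not depend on the sup norm of `w`
in the second use, so the bound persists up to `T* = T_max`. -/

noncomputable section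

/-! ### Lyapunov polynomials: derivatives and size -/

namespace TridiagRD

variable {m : ℕ}

/-- The Lyapunov polynomials: `lyap θ n β W` is the sum over all words of length `n` in the letters
`1, …, m` of `∏ θ_i ^ (β_i + number of occurrences of i)²` times the corresponding monomial. -/
def lyap (θ : Fin m → ℝ) : ℕ → (Fin m → ℕ) → (Fin m → ℝ) → ℝ
  | 0, β, _ => ∏ i, θ i ^ (β i ^ 2)
  | n + 1, β, W => ∑ j, W j * lyap θ n (β + Pi.single j 1) W

theorem lyap_zero (θ : Fin m → ℝ) (β : Fin m → ℕ) (W : Fin m → ℝ) :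
    lyap θ 0 β W = ∏ i, θ i ^ (β i ^ 2) := rfl

theorem lyap_succ (θ : Fin m → ℝ) (n : ℕ) (β : Fin m → ℕ) (W : Fin m → ℝ) :
    lyap θ (n + 1) β W = ∑ j, W j * lyap θ n (β + Pi.single j 1) W := rfl

/-- The continuous linear form on `ℝ^m` with the given coefficients. -/
def coordForm (c : Fin m → ℝ) : (Fin m → ℝ) →L[ℝ] ℝ :=
  ∑ j, c j • ContinuousLinearMap.proj (R := ℝ) (φ := fun _ : Fin m => ℝ) j

@[simp]
theorem coordForm_apply (c v : Fin m → ℝ) : coordForm c v = ∑ j, c j * v j := by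
  simp [coordForm]

/-- Differentiating the leading letter of the recursion gives one copy of the shifted polynomial;
differentiating the remaining word gives the others, by induction, since the shifts by `e_j` and
`e_k` commute. -/
theorem hasFDerivAt_lyap_succ (θ : Fin m → ℝ) (n : ℕ) (β : Fin m → ℕ) (W : Fin m → ℝ) :
    HasFDerivAt (lyap θ (n + 1) β)
      (coordForm fun j => (n + 1 : ℝ) * lyap θ n (β + Pi.single j 1) W) W := by
  induction n generalizing β with
  | zero =>
    have h : HasFDerivAt (fun W : Fin m → ℝ => ∑ j, W j * lyap θ 0 (β + Pi.single j 1) W)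
        (∑ j, lyap θ 0 (β + Pi.single j 1) W •
          ContinuousLinearMap.proj (R := ℝ) (φ := fun _ : Fin m => ℝ) j) W := by
      refine HasFDerivAt.fun_sum fun j _ => ?_
      simp only [lyap_zero]
      exact (hasFDerivAt_apply j W).mul_const _
    refine h.congr_fderiv ?_
    ext v
    simp
  | succ n ih =>
    have h : HasFDerivAt (fun W : Fin m → ℝ => ∑ j, W j * lyap θ (n + 1) (β + Pi.single j 1) W)
        (∑ j, (W j • coordForm
            (fun k => (n + 1 : ℝ) * lyap θ n (β + Pi.single j 1 + Pi.single k 1) W)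
          + lyap θ (n + 1) (β + Pi.single j 1) W •
          ContinuousLinearMap.proj (R := ℝ) (φ := fun _ : Fin m => ℝ) j)) W := by
      refine HasFDerivAt.fun_sum fun j _ => ?_
      exact (hasFDerivAt_apply j W).mul (ih (β + Pi.single j 1))
    refine h.congr_fderiv ?_
    ext v
    simp only [coordForm_apply, sum_apply, add_apply,
      smul_apply, ContinuousLinearMap.proj_apply, smul_eq_mul,
      Finset.sum_add_distrib, Finset.mul_sum]
    rw [Finset.sum_comm, ← Finset.sum_add_distrib]
    refine Finset.sum_congr rfl fun k _ => ?_
    have e : ∀ j, W j * ((n + 1 : ℝ) * lyap θ n (β + Pi.single j 1 + Pi.single k 1) W * v k)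
        = (n + 1 : ℝ) * v k * (W j * lyap θ n (β + Pi.single k 1 + Pi.single j 1) W) := by
      intro j
      rw [add_right_comm β]
      ring
    rw [Finset.sum_congr rfl fun j _ => e j, ← Finset.mul_sum, ← lyap_succ]
    push_cast
    ring

theorem continuous_lyap (θ : Fin m → ℝ) (n : ℕ) (β : Fin m → ℕ) : Continuous (lyap θ n β) := by
  cases n with
  | zero => exact continuous_const
  | succ n =>
    exact continuous_iff_continuousAt.2 fun W => (hasFDerivAt_lyap_succ θ n β W).continuousAt

/-- All weights are at least `1`, and with unit weights the sum over words is exactly the power of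
the sum. -/
theorem sum_pow_le_lyap {θ : Fin m → ℝ} (hθ : ∀ i, 1 ≤ θ i) (n : ℕ) (β : Fin m → ℕ)
    {W : Fin m → ℝ} (hW : W ∈ orthant m) : (∑ k, W k) ^ n ≤ lyap θ n β W := by
  induction n generalizing β with
  | zero =>
    rw [lyap_zero, pow_zero]
    exact Finset.one_le_prod fun i _ => one_le_pow₀ (hθ i)
  | succ n ih =>
    rw [lyap_succ, pow_succ', Finset.sum_mul]
    exact Finset.sum_le_sum fun j _ => mul_le_mul_of_nonneg_left (ih _) (hW j)

theorem sum_nonneg_of_mem_orthant {W : Fin m → ℝ} (hW : W ∈ orthant m) : 0 ≤ ∑ k, W k :=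
  Finset.sum_nonneg fun k _ => hW k

theorem lyap_nonneg {θ : Fin m → ℝ} (hθ : ∀ i, 1 ≤ θ i) (n : ℕ) (β : Fin m → ℕ)
    {W : Fin m → ℝ} (hW : W ∈ orthant m) : 0 ≤ lyap θ n β W :=
  (pow_nonneg (sum_nonneg_of_mem_orthant hW) n).trans (sum_pow_le_lyap hθ n β hW)

theorem exists_lyap_le (θ : Fin m → ℝ) (n : ℕ) (β : Fin m → ℕ) :
    ∃ C, 0 ≤ C ∧ ∀ W ∈ orthant m, lyap θ n β W ≤ C * (∑ k, W k) ^ n := by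
  induction n generalizing β with
  | zero => exact ⟨|∏ i, θ i ^ (β i ^ 2)|, abs_nonneg _, fun W _ => by
      rw [lyap_zero, pow_zero, mul_one]; exact le_abs_self _⟩
  | succ n ih =>
    choose C hC0 hC using fun j => ih (β + Pi.single j 1)
    refine ⟨∑ j, C j, Finset.sum_nonneg fun j _ => hC0 j, fun W hW => ?_⟩
    have hs := sum_nonneg_of_mem_orthant hW
    rw [lyap_succ, pow_succ', mul_comm (∑ k, W k), ← mul_assoc, Finset.mul_sum]
    refine Finset.sum_le_sum fun j _ => ?_
    rw [mul_comm (W j)]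
    refine mul_le_mul_of_nonneg_right ((hC j W hW).trans ?_) (hW j)
    exact mul_le_mul_of_nonneg_right
      (Finset.single_le_sum (fun j _ => hC0 j) (Finset.mem_univ j)) (pow_nonneg hs n)

/-! ### Choice of the weights and convexity along the diffusion -/

/-- The weights: `1` for the last component and `Θ` for all others. -/
def weight (m : ℕ) (Θ : ℝ) (i : Fin m) : ℝ := if (i : ℕ) + 1 = m then 1 else Θ

theorem one_le_weight {Θ : ℝ} (hΘ : 1 ≤ Θ) (i : Fin m) : 1 ≤ weight m Θ i := by
  unfold weight; split_ifs <;> linarith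

theorem prod_pow_add_single (θ : Fin m → ℝ) (β : Fin m → ℕ) (j : Fin m) :
    ∏ i, θ i ^ ((β + Pi.single j 1 : Fin m → ℕ) i ^ 2) =
      (∏ i, θ i ^ (β i ^ 2)) * θ j ^ (2 * β j + 1) := by
  have h : ∀ i, θ i ^ ((β + Pi.single j 1 : Fin m → ℕ) i ^ 2)
      = θ i ^ (β i ^ 2) * (if i = j then θ j ^ (2 * β j + 1) else 1) := by
    intro i
    by_cases hij : i = j
    · subst hij
      rw [if_pos rfl, ← pow_add, Pi.add_apply, Pi.single_eq_same]
      congr 1; ring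
    · simp [hij]
  simp_rw [h, Finset.prod_mul_distrib]
  simp

theorem prod_pow_add_single_add_single (θ : Fin m → ℝ) (β : Fin m → ℕ) (i j : Fin m) :
    ∏ k, θ k ^ ((β + Pi.single i 1 + Pi.single j 1 : Fin m → ℕ) k ^ 2) =
      (∏ k, θ k ^ (β k ^ 2)) * (θ i ^ (2 * β i + 1) * θ j ^ (2 * β j + 1)) *
        (if i = j then θ i ^ 2 else 1) := by
  rw [prod_pow_add_single, prod_pow_add_single]
  by_cases hij : i = j
  · subst hij
    simp
    ring
  · rw [if_neg hij]
    simp [Ne.symm hij]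
    ring

/-- If the weights are large, all combinations `Σ λ_i ∂_i∂_j lyap ξ_i ξ_j` are nonnegative. -/
theorem exists_weight_quadratic (lam : Fin m → ℝ) (hlam : ∀ i, 0 < lam i) :
    ∃ Θ₀ : ℝ, 1 ≤ Θ₀ ∧ ∀ Θ, Θ₀ ≤ Θ → ∀ ζ : Fin m → ℝ,
      0 ≤ ∑ i, ∑ j, lam i * (if i = j then weight m Θ i ^ 2 else 1) * (ζ i * ζ j) := by
  rcases Nat.eq_zero_or_pos m with rfl | hm
  · exact ⟨1, le_rfl, fun _ _ _ => by simp⟩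
  let l : Fin m := ⟨m - 1, by omega⟩
  have hl : ∀ i : Fin m, (i : ℕ) + 1 = m ↔ i = l := by
    intro i; rw [Fin.ext_iff]; simp only [l]; omega
  -- `R i` is chosen so that `lam l / m * S² + (lam i - lam l) ζ_i S + lam i * R i * ζ_i²` is a
  -- perfect square.
  let R : Fin m → ℝ := fun i => m * (lam i - lam l) ^ 2 / (4 * lam l * lam i)
  have hR : ∀ i, 0 ≤ R i := fun i => by
    have := hlam i; have := hlam l; positivity
  refine ⟨1 + ∑ i, R i, by linarith [Finset.sum_nonneg fun i (_ : i ∈ Finset.univ) => hR i], ?_⟩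
  intro Θ hΘ ζ
  have hRΘ : ∀ i, R i ≤ Θ ^ 2 - 1 := fun i => by
    have h1 := Finset.single_le_sum (fun i _ => hR i) (Finset.mem_univ i)
    have h2 : R i ≤ Θ - 1 := by linarith
    nlinarith [hR i]
  set S := ∑ j, ζ j with hS
  have e1 : ∑ i, ∑ j, lam i * (if i = j then weight m Θ i ^ 2 else 1) * (ζ i * ζ j)
      = ∑ i, (lam i * ζ i * S + lam i * (weight m Θ i ^ 2 - 1) * ζ i ^ 2) := by
    refine Finset.sum_congr rfl fun i _ => ?_
    have : ∀ j, lam i * (if i = j then weight m Θ i ^ 2 else 1) * (ζ i * ζ j)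
        = lam i * ζ i * ζ j + (if i = j then lam i * (weight m Θ i ^ 2 - 1) * ζ i ^ 2 else 0) := by
      intro j
      split_ifs with h
      · subst h; ring
      · ring
    simp_rw [this, Finset.sum_add_distrib, ← Finset.mul_sum]
    simp [hS]
  -- The part `lam l * S²` of `Σ lam i ζ_i S` is distributed equally over the `m` indices, so that
  -- each summand can be treated alone. For `i = l` the mixed term vanishes and no large weight is
  -- needed.
  have e2 : ∑ i, (lam i * ζ i * S + lam i * (weight m Θ i ^ 2 - 1) * ζ i ^ 2)
      = ∑ i, (lam l / m * S ^ 2 + (lam i - lam l) * ζ i * S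
          + lam i * (weight m Θ i ^ 2 - 1) * ζ i ^ 2) := by
    simp_rw [Finset.sum_add_distrib]
    congr 1
    have : ∑ i, (lam i - lam l) * ζ i * S = ∑ i, lam i * ζ i * S - lam l * S * S := by
      simp_rw [sub_mul, Finset.sum_sub_distrib]
      rw [← Finset.sum_mul, ← Finset.sum_mul, ← Finset.mul_sum, ← hS]
    rw [this]
    simp only [Finset.sum_const, Finset.card_univ, Fintype.card_fin, nsmul_eq_mul]
    have hm0 : (m : ℝ) ≠ 0 := by positivity
    rw [← mul_assoc, mul_div_cancel₀ _ hm0]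
    ring
  rw [e1, e2]
  refine Finset.sum_nonneg fun i _ => ?_
  have hl0 := hlam l
  have hi0 := hlam i
  have hm0 : (0 : ℝ) < m := by exact_mod_cast hm
  by_cases hi : i = l
  · have : weight m Θ i = 1 := if_pos ((hl i).2 hi)
    rw [this, hi]
    have : 0 ≤ lam l / m * S ^ 2 := by positivity
    nlinarith
  · have : weight m Θ i = Θ := if_neg fun h => hi ((hl i).1 h)
    rw [this]
    have h3 : lam i * R i * ζ i ^ 2 ≤ lam i * (Θ ^ 2 - 1) * ζ i ^ 2 :=
      mul_le_mul_of_nonneg_right (mul_le_mul_of_nonneg_left (hRΘ i) hi0.le) (sq_nonneg _)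
    have h4 : lam l / m * S ^ 2 + (lam i - lam l) * ζ i * S + lam i * R i * ζ i ^ 2
        = lam l / m * (S + m * (lam i - lam l) / (2 * lam l) * ζ i) ^ 2 := by
      simp only [R]
      field_simp
      ring
    have h5 : 0 ≤ lam l / m * (S + m * (lam i - lam l) / (2 * lam l) * ζ i) ^ 2 := by positivity
    linarith

/-- In degree `0` the form is a nonnegative multiple of the basic form at `ζ_i = θ_i ^ (2 β_i + 1)
ξ_i`. In higher degree it is a combination of forms of lower degree with the nonnegative
coefficients `W_k`. -/
theorem lyap_quadratic_nonneg {lam : Fin m → ℝ} {Θ : ℝ} (hΘ : 0 ≤ Θ)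
    (hq : ∀ ζ : Fin m → ℝ,
      0 ≤ ∑ i, ∑ j, lam i * (if i = j then weight m Θ i ^ 2 else 1) * (ζ i * ζ j))
    (n : ℕ) (β : Fin m → ℕ) {W : Fin m → ℝ} (hW : W ∈ orthant m) (ξ : Fin m → ℝ) :
    0 ≤ ∑ i, ∑ j, lam i * lyap (weight m Θ) n (β + Pi.single i 1 + Pi.single j 1) W
      * (ξ i * ξ j) := by
  induction n generalizing β with
  | zero =>
    have h := hq fun i => weight m Θ i ^ (2 * β i + 1) * ξ i
    have hP : 0 ≤ ∏ k, weight m Θ k ^ (β k ^ 2) :=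
      Finset.prod_nonneg fun k _ => pow_nonneg (by unfold weight; split_ifs <;> linarith) _
    refine (mul_nonneg hP h).trans_eq ?_
    simp_rw [Finset.mul_sum]
    refine Finset.sum_congr rfl fun i _ => Finset.sum_congr rfl fun j _ => ?_
    rw [lyap_zero, prod_pow_add_single_add_single]
    ring
  | succ n ih =>
    have e : ∑ i, ∑ j, lam i * lyap (weight m Θ) (n + 1) (β + Pi.single i 1 + Pi.single j 1) W
        * (ξ i * ξ j) = ∑ k, W k * ∑ i, ∑ j, lam i *
          lyap (weight m Θ) n (β + Pi.single k 1 + Pi.single i 1 + Pi.single j 1) W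
        * (ξ i * ξ j) := by
      simp_rw [Finset.mul_sum]
      rw [Finset.sum_comm]
      conv_rhs => rw [Finset.sum_comm]
      conv_lhs => rw [Finset.sum_comm]
      refine Finset.sum_congr rfl fun i _ => ?_
      rw [Finset.sum_comm]
      refine Finset.sum_congr rfl fun j _ => ?_
      rw [lyap_succ, Finset.mul_sum, Finset.sum_mul]
      refine Finset.sum_congr rfl fun k _ => ?_
      rw [show β + Pi.single i 1 + Pi.single j 1 + Pi.single k 1
        = β + Pi.single k 1 + Pi.single i 1 + Pi.single j 1 by abel]
      ring
    rw [e]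
    exact Finset.sum_nonneg fun k _ => mul_nonneg (hW k) (ih _)

/-! ### Reaction terms and boundary fluxes -/

/-- The recursion reduces to degree `0`, where linear control applies; each further letter costs one
factor `W_k ≤ 1 + Σ W`. -/
theorem exists_lyap_reaction_le {F : (Fin m → ℝ) → Fin m → ℝ} {Θ : ℝ} (hΘ : 1 ≤ Θ)
    {Dbar : Fin m → ℝ} (hD : ∀ ℓ, Dbar ℓ ≤ Θ)
    (hF : ∀ D : Fin m → ℝ, (∀ ℓ, Dbar ℓ ≤ D ℓ) → ∃ C > (0 : ℝ), ∀ W ∈ orthant m,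
        ∑ ℓ : Fin m, (if (ℓ : ℕ) + 1 = m then 1 else D ℓ) * F W ℓ ≤ C * (1 + ∑ k, W k))
    (n : ℕ) (β : Fin m → ℕ) :
    ∃ C, 0 ≤ C ∧ ∀ W ∈ orthant m,
      ∑ j, lyap (weight m Θ) n (β + Pi.single j 1) W * F W j ≤ C * (1 + ∑ k, W k) ^ (n + 1) := by
  induction n generalizing β with
  | zero =>
    -- The coefficients depend on `β`, which is why linear control is needed for all large
    -- coefficients at once. The odd exponents are at least `1`, so these coefficients are at least
    -- `Θ`.
    obtain ⟨C, hC, h⟩ := hF (fun ℓ => Θ ^ (2 * β ℓ + 1))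
      fun ℓ => (hD ℓ).trans (le_self_pow₀ hΘ (by omega))
    have hP : 0 ≤ ∏ k, weight m Θ k ^ (β k ^ 2) :=
      Finset.prod_nonneg fun k _ => pow_nonneg (zero_le_one.trans (one_le_weight hΘ k)) _
    refine ⟨(∏ k, weight m Θ k ^ (β k ^ 2)) * C, by positivity, fun W hW => ?_⟩
    refine Eq.trans_le ?_ ((mul_le_mul_of_nonneg_left (h W hW) hP).trans_eq (by ring))
    rw [Finset.mul_sum]
    refine Finset.sum_congr rfl fun j _ => ?_
    rw [lyap_zero, prod_pow_add_single, mul_assoc]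
    congr 2
    unfold weight
    split_ifs <;> simp
  | succ n ih =>
    choose C hC0 hC using fun j => ih (β + Pi.single j 1)
    refine ⟨∑ k, C k, Finset.sum_nonneg fun k _ => hC0 k, fun W hW => ?_⟩
    have hs := sum_nonneg_of_mem_orthant hW
    have e : ∑ j, lyap (weight m Θ) (n + 1) (β + Pi.single j 1) W * F W j
        = ∑ k, W k * ∑ j, lyap (weight m Θ) n (β + Pi.single k 1 + Pi.single j 1) W * F W j := by
      simp_rw [lyap_succ, Finset.mul_sum, Finset.sum_mul]
      rw [Finset.sum_comm]
      refine Finset.sum_congr rfl fun k _ => Finset.sum_congr rfl fun j _ => ?_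
      rw [add_right_comm β]
      ring
    rw [e, Finset.sum_mul]
    refine Finset.sum_le_sum fun k _ => ?_
    have hk : W k ≤ 1 + ∑ k, W k := by
      linarith [Finset.single_le_sum (fun k _ => hW k) (Finset.mem_univ k)]
    calc _ ≤ W k * (C k * (1 + ∑ k, W k) ^ (n + 1)) :=
          mul_le_mul_of_nonneg_left (hC k W hW) (hW k)
      _ ≤ (1 + ∑ k, W k) * (C k * (1 + ∑ k, W k) ^ (n + 1)) :=
          mul_le_mul_of_nonneg_right hk (mul_nonneg (hC0 k) (by positivity))
      _ = _ := by ring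

theorem one_add_pow_le_two_pow_mul {s : ℝ} (hs : 0 ≤ s) (n : ℕ) :
    (1 + s) ^ n ≤ 2 ^ n * (1 + s ^ n) := by
  rcases le_total s 1 with h | h
  · calc (1 + s) ^ n ≤ 2 ^ n := pow_le_pow_left₀ (by linarith) (by linarith) n
      _ ≤ _ := le_mul_of_one_le_right (by positivity) (by linarith [pow_nonneg hs n])
  · calc (1 + s) ^ n ≤ (2 * s) ^ n := pow_le_pow_left₀ (by linarith) (by linarith) n
      _ = 2 ^ n * s ^ n := mul_pow _ _ _
      _ ≤ _ := mul_le_mul_of_nonneg_left (by linarith) (by positivity)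

/-- The boundary fluxes of the Lyapunov polynomials are bounded above. -/
theorem exists_lyap_boundary_le {lam : Fin m → ℝ} (hlam : ∀ i, 0 < lam i) {θ : Fin m → ℝ}
    (hθ : ∀ i, 1 ≤ θ i) {α : ℝ} {ρ : Fin m → ℝ} (hρ : ∀ ℓ, 0 ≤ ρ ℓ)
    (hbc : (0 < α ∧ α < 1) ∨ (α = 0 ∧ ∀ ℓ, ρ ℓ = 0) ∨ (α = 1 ∧ ∀ ℓ, ρ ℓ = 0))
    {n : ℕ} (hn : n ≠ 0) :
    ∃ C, 0 ≤ C ∧ ∀ W ∈ orthant m, ∀ ξ : Fin m → ℝ, (∀ j, α * W j + (1 - α) * ξ j = ρ j) →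
      ∑ j, lam j * lyap θ n (Pi.single j 1) W * ξ j ≤ C := by
  rcases hbc with ⟨hα0, hα1⟩ | ⟨rfl, h0⟩ | ⟨rfl, h0⟩
  · choose C hC0 hC using fun j : Fin m => exists_lyap_le θ n (Pi.single j 1)
    have h1α : 0 < 1 - α := by linarith
    rcases Nat.eq_zero_or_pos m with rfl | hm
    · exact ⟨0, le_rfl, fun W _ ξ _ => by simp⟩
    have hne : (Finset.univ : Finset (Fin m)).Nonempty := ⟨⟨0, hm⟩, Finset.mem_univ _⟩
    obtain ⟨c, hc0, hc⟩ : ∃ c, 0 < c ∧ ∀ j, c ≤ lam j := by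
      obtain ⟨j, -, hj⟩ := Finset.exists_min_image Finset.univ lam hne
      exact ⟨lam j, hlam j, fun i => hj i (Finset.mem_univ i)⟩
    set B := ∑ j, lam j * C j * ρ j with hB
    have hB0 : 0 ≤ B := Finset.sum_nonneg fun j _ =>
      mul_nonneg (mul_nonneg (hlam j).le (hC0 j)) (hρ j)
    -- With `s = Σ W` the flux is at most `(1 - α)⁻¹ s^n (B - c α s)`, which is nonpositive for `s ≥
    -- B / (c α)`; below this threshold `s^n` is bounded.
    refine ⟨(1 - α)⁻¹ * (B * (B / (c * α)) ^ n), by positivity, fun W hW ξ hξ => ?_⟩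
    set s := ∑ k, W k with hs
    have hs0 : 0 ≤ s := sum_nonneg_of_mem_orthant hW
    have hξ' : ∀ j, ξ j = (1 - α)⁻¹ * (ρ j - α * W j) := fun j => by
      rw [← hξ j]; field_simp; ring
    have e : ∑ j, lam j * lyap θ n (Pi.single j 1) W * ξ j
        = (1 - α)⁻¹ * ∑ j, lam j * lyap θ n (Pi.single j 1) W * (ρ j - α * W j) := by
      rw [Finset.mul_sum]
      refine Finset.sum_congr rfl fun j _ => ?_
      rw [hξ']; ring
    rw [e]
    refine mul_le_mul_of_nonneg_left ?_ (inv_nonneg.2 h1α.le)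
    have h1 : ∑ j, lam j * lyap θ n (Pi.single j 1) W * (ρ j - α * W j)
        ≤ ∑ j, (lam j * C j * ρ j * s ^ n - c * α * s ^ n * W j) := by
      refine Finset.sum_le_sum fun j _ => ?_
      have a1 : lam j * ρ j * lyap θ n (Pi.single j 1) W ≤ lam j * ρ j * (C j * s ^ n) :=
        mul_le_mul_of_nonneg_left (hC j W hW) (mul_nonneg (hlam j).le (hρ j))
      have a2 : c * s ^ n ≤ lam j * lyap θ n (Pi.single j 1) W :=
        mul_le_mul (hc j) (sum_pow_le_lyap hθ n _ hW) (by positivity) (hlam j).le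
      have a3 := mul_le_mul_of_nonneg_right a2 (mul_nonneg hα0.le (hW j))
      nlinarith
    refine h1.trans ?_
    rw [Finset.sum_sub_distrib, ← Finset.sum_mul, ← Finset.mul_sum, ← hB, ← hs]
    rcases le_total (c * α * s) B with h | h
    · have : s ≤ B / (c * α) := by rw [le_div_iff₀ (by positivity)]; linarith
      have h2 : B * s ^ n ≤ B * (B / (c * α)) ^ n :=
        mul_le_mul_of_nonneg_left (pow_le_pow_left₀ hs0 this n) hB0
      have : 0 ≤ c * α * s ^ n * s := by positivity
      linarith
    · have h2 : B * s ^ n ≤ c * α * s * s ^ n := mul_le_mul_of_nonneg_right h (by positivity)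
      have : 0 ≤ B * (B / (c * α)) ^ n := by positivity
      nlinarith
  · refine ⟨0, le_rfl, fun W _ ξ hξ => ?_⟩
    have : ∀ j, ξ j = 0 := fun j => by simpa [h0] using hξ j
    simp [this]
  · refine ⟨0, le_rfl, fun W _ ξ hξ => ?_⟩
    have : ∀ j, W j = 0 := fun j => by simpa [h0] using hξ j
    -- In the Dirichlet case `ξ` is arbitrary, but a polynomial of positive degree without lower
    -- order terms vanishes at `W = 0`.
    obtain ⟨k, rfl⟩ := Nat.exists_eq_succ_of_ne_zero hn
    simp [lyap_succ, this]

/-- The angle is at most `π - π / (m + 1)`, so the cosine is at least `-cos (π / (m + 1))`. -/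
theorem diffusionEigenvalue_pos {a b : ℝ} (hb : 0 < b)
    (hab : 2 * b * Real.cos (Real.pi / ((m : ℝ) + 1)) < a) (ℓ : Fin m) :
    0 < diffusionEigenvalue m a b ℓ := by
  have hm1 : (0 : ℝ) < (m : ℝ) + 1 := by positivity
  have hℓ : (ℓ : ℝ) + 1 ≤ m := by exact_mod_cast ℓ.2
  have hℓ0 : (0 : ℝ) ≤ ℓ := by positivity
  have key : -Real.cos (Real.pi / ((m : ℝ) + 1))
      ≤ Real.cos (((m : ℝ) - (ℓ : ℝ)) * Real.pi / ((m : ℝ) + 1)) := by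
    rw [← Real.cos_pi_sub]
    have hpi := Real.pi_pos
    refine Real.cos_le_cos_of_nonneg_of_le_pi ?_ ?_ ?_
    · exact div_nonneg (mul_nonneg (by linarith) hpi.le) hm1.le
    · have : 0 ≤ Real.pi / ((m : ℝ) + 1) := by positivity
      linarith
    · rw [le_sub_iff_add_le, ← add_div, div_le_iff₀ hm1]
      nlinarith
  unfold diffusionEigenvalue
  nlinarith

end TridiagRD

/-! ### Boundary charts and collars -/

namespace TridiagRD

variable {d : ℕ}

/-- In the ball of radius `r` about `x`, the set `Ω` is `{φ < 0}` with `φ` of class `C¹` and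
strictly increasing in the direction `v`. -/
structure IsBoundaryChart (Ω : Set (Space d)) (x : Space d) (r : ℝ) (φ : Space d → ℝ)
    (v : Space d) (c : ℝ) : Prop where
  radius_pos : 0 < r
  slope_pos : 0 < c
  contDiffAt : ∀ y ∈ Metric.ball x r, ContDiffAt ℝ 1 φ y
  mem_iff : ∀ y ∈ Metric.ball x r, (y ∈ Ω ↔ φ y < 0)
  slope_le : ∀ y ∈ Metric.ball x r, c ≤ fderiv ℝ φ y v

/-- The direction `v` is the gradient at the centre; by continuity half of the slope `‖v‖²` survives
on a small ball. -/
theorem IsLocalDefiningFunction.exists_isBoundaryChart {Ω : Set (Space d)} {x : Space d}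
    {φ : Space d → ℝ} (h : IsLocalDefiningFunction Ω x φ) :
    ∃ r v c, IsBoundaryChart Ω x r φ v c := by
  obtain ⟨h1, h2, h3⟩ := h
  set v := gradient φ x
  have hv : 0 < ‖v‖ ^ 2 := by positivity
  have hx : fderiv ℝ φ x v = ‖v‖ ^ 2 := by
    rw [← inner_gradient_left, real_inner_self_eq_norm_sq]
  have hcont : ContinuousAt (fun y => fderiv ℝ φ y v) x :=
    (h1.continuousAt_fderiv one_ne_zero).clm_apply continuousAt_const
  have h4 : ∀ᶠ y in 𝓝 x, ‖v‖ ^ 2 / 2 < fderiv ℝ φ y v :=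
    hcont.eventually (lt_mem_nhds (show _ < fderiv ℝ φ x v by rw [hx]; linarith))
  obtain ⟨r, hr, hball⟩ := Metric.eventually_nhds_iff_ball.1
    ((h1.eventually (by simp)).and (h3.and h4))
  exact ⟨r, v, ‖v‖ ^ 2 / 2, hr, by linarith, fun y hy => (hball y hy).1,
    fun y hy => (hball y hy).2.1, fun y hy => (hball y hy).2.2.le⟩

namespace IsBoundaryChart

variable {Ω : Set (Space d)} {x : Space d} {r : ℝ} {φ : Space d → ℝ} {v : Space d} {c : ℝ}

theorem continuousOn (h : IsBoundaryChart Ω x r φ v c) : ContinuousOn φ (Metric.ball x r) :=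
  fun y hy => (h.contDiffAt y hy).continuousAt.continuousWithinAt

theorem isOpen_collar (h : IsBoundaryChart Ω x r φ v c) (ε : ℝ) :
    IsOpen (Metric.ball x r ∩ φ ⁻¹' Ioo (-ε) 0) :=
  h.continuousOn.isOpen_inter_preimage Metric.isOpen_ball isOpen_Ioo

theorem gradient_ne_zero (h : IsBoundaryChart Ω x r φ v c) {y : Space d}
    (hy : y ∈ Metric.ball x r) : gradient φ y ≠ 0 := by
  intro h0
  have := h.slope_le y hy
  rw [← inner_gradient_left, h0, inner_zero_left] at this
  linarith [h.slope_pos]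

theorem isLocalDefiningFunction (h : IsBoundaryChart Ω x r φ v c) {y : Space d}
    (hy : y ∈ Metric.ball x r) : IsLocalDefiningFunction Ω y φ :=
  ⟨h.contDiffAt y hy, h.gradient_ne_zero hy,
    Filter.mem_of_superset (Metric.isOpen_ball.mem_nhds hy) fun z hz => h.mem_iff z hz⟩

/-- The collar `{-ε < φ < 0}` has volume `O(ε)`: it has about `1 / ε` disjoint translates in a
bounded set. -/
theorem exists_volume_collar_le (h : IsBoundaryChart Ω x r φ v c) :
    ∃ C, 0 ≤ C ∧ ∀ ε > 0, volume.real (Metric.ball x r ∩ φ ⁻¹' Ioo (-ε) 0) ≤ C * ε := by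
  have hc := h.slope_pos
  have hr := h.radius_pos
  have hv : 0 < ‖v‖ := by
    rw [norm_pos_iff]
    rintro rfl
    have := h.slope_le x (Metric.mem_ball_self hr)
    rw [map_zero] at this
    linarith
  set μ2 := volume.real (Metric.ball x (2 * r)) with hμ2
  refine ⟨μ2 * ‖v‖ / (c * r), by positivity, fun ε hε => ?_⟩
  set A := Metric.ball x r ∩ φ ⁻¹' Ioo (-ε) 0 with hA
  -- A shift by `s • v` with `s ≥ τ` raises `φ` by at least `c τ = ε`, hence leads out of the
  -- collar.
  set τ := ε / c with hτ
  have hτ0 : 0 < τ := by positivity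
  -- The shifts `k τ v` with `k < N` have length less than `r`, so the translates stay in the ball
  -- of radius `2 r`.
  set N := ⌈r / (τ * ‖v‖)⌉₊ with hN
  have hNle : r / (τ * ‖v‖) ≤ N := Nat.le_ceil _
  have hstep : ∀ y ∈ A, ∀ z ∈ A, ∀ s : ℝ, τ ≤ s → z ≠ y + s • v := by
    rintro y ⟨hy, hy1, -⟩ z ⟨hz, -, hz2⟩ s hs rfl
    obtain ⟨ζ, hζ, he⟩ := domain_mvt (f := φ) (s := Metric.ball x r) (f' := fderiv ℝ φ)
      (fun y hy => ((h.contDiffAt y hy).differentiableAt one_ne_zero).hasFDerivAt.hasFDerivWithinAt)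
      (convex_ball x r) hy hz
    have hζ' := (convex_ball x r).segment_subset hy hz hζ
    rw [add_sub_cancel_left, map_smul, smul_eq_mul] at he
    have h1 := h.slope_le ζ hζ'
    have h2 : τ * c ≤ s * fderiv ℝ φ ζ v := mul_le_mul hs h1 hc.le (hτ0.le.trans hs)
    have h3 : τ * c = ε := div_mul_cancel₀ _ hc.ne'
    linarith
  let T : ℕ → Set (Space d) := fun k => (fun y => y + -((k * τ) • v)) ⁻¹' A
  have hTdisj : ((Finset.range N : Finset ℕ) : Set ℕ).PairwiseDisjoint T := by
    have aux : ∀ j k : ℕ, j < k → Disjoint (T j) (T k) := by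
      intro j k hjk
      refine Set.disjoint_left.2 fun z hj hk => ?_
      refine hstep _ hk _ hj ((k - j : ℝ) * τ) ?_ ?_
      · have : (j : ℝ) + 1 ≤ k := by exact_mod_cast hjk
        nlinarith
      · module
    intro j _ k _ hjk
    rcases lt_or_gt_of_ne hjk with hlt | hlt
    · exact aux j k hlt
    · exact (aux k j hlt).symm
  have hTmeas : ∀ k ∈ Finset.range N, MeasurableSet (T k) := fun k _ =>
    (h.isOpen_collar ε).measurableSet.preimage (measurable_id.add_const _)
  have hTsub : (⋃ k ∈ Finset.range N, T k) ⊆ Metric.ball x (2 * r) := by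
    refine iUnion₂_subset fun k hk z hz => ?_
    have hk' : (k : ℝ) < r / (τ * ‖v‖) := Nat.lt_ceil.1 (Finset.mem_range.1 hk)
    rw [lt_div_iff₀ (by positivity)] at hk'
    have hz1 : dist (z + -((k * τ) • v)) x < r := hz.1
    have hz2 : dist z (z + -((k * τ) • v)) < r := by
      rw [dist_eq_norm, sub_add_cancel_left, neg_neg, norm_smul,
        Real.norm_of_nonneg (by positivity)]
      linarith
    rw [Metric.mem_ball]
    linarith [dist_triangle z (z + -((k * τ) • v)) x]
  have hle : (N : ℝ) * volume.real A ≤ μ2 := by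
    have h1 : volume.real (⋃ k ∈ Finset.range N, T k) = ∑ k ∈ Finset.range N, volume.real A := by
      rw [Measure.real, measure_biUnion_finset hTdisj hTmeas]
      simp only [T, measure_preimage_add_right]
      rw [ENNReal.toReal_sum]
      · rfl
      · intro _ _
        exact ((measure_mono inter_subset_left).trans_lt measure_ball_lt_top).ne
    rw [Finset.sum_const, Finset.card_range, nsmul_eq_mul] at h1
    rw [← h1]
    exact measureReal_mono hTsub measure_ball_lt_top.ne
  have h2 : r / (τ * ‖v‖) * volume.real A ≤ μ2 :=
    (mul_le_mul_of_nonneg_right hNle measureReal_nonneg).trans hle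
  rw [div_mul_eq_mul_div, div_le_iff₀ (by positivity)] at h2
  have h3 : volume.real A ≤ μ2 * (τ * ‖v‖) / r := by
    rw [le_div_iff₀ hr]; linarith
  refine h3.trans_eq ?_
  rw [hτ]
  field_simp

/-- Near the boundary, the normal component of a vector field is controlled by its boundary
values. -/
theorem exists_fderiv_apply_le (h : IsBoundaryChart Ω x r φ v c) (hΩ : IsOpen Ω) {K : Set (Space d)}
    (hK : IsCompact K) (hKball : K ⊆ Metric.ball x r) {G : ℝ} (hG : ∀ y ∈ K, ‖gradient φ y‖ ≤ G)
    {t₁ t₂ Cb δ : ℝ} (hCb : 0 ≤ Cb) (hδ : 0 < δ) {V : ℝ → Space d → Space d}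
    (hV : ContinuousOn (fun q : ℝ × Space d => V q.1 q.2) (Icc t₁ t₂ ×ˢ closure Ω))
    (hbd : ∀ t ∈ Icc t₁ t₂, ∀ y ∈ frontier Ω, ∀ η, IsOutwardUnitNormal Ω y η →
      inner ℝ (V t y) η ≤ Cb) :
    ∃ ε₀ > 0, ∀ t ∈ Icc t₁ t₂, ∀ y ∈ K ∩ Ω, -ε₀ < φ y → fderiv ℝ φ y (V t y) ≤ G * Cb + δ := by
  have hfd : ContinuousOn (fun q : ℝ × Space d => fderiv ℝ φ q.2 (V q.1 q.2))
      (Icc t₁ t₂ ×ˢ (K ∩ closure Ω)) := by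
    refine ContinuousOn.clm_apply (fun q hq => ?_)
      (hV.mono (prod_mono_right inter_subset_right))
    exact (((h.contDiffAt q.2 (hKball hq.2.1)).continuousAt_fderiv one_ne_zero).comp
      continuousAt_snd).continuousWithinAt
  have hcpt : IsCompact (Icc t₁ t₂ ×ˢ (K ∩ closure Ω)) :=
    isCompact_Icc.prod (hK.inter_right isClosed_closure)
  -- `Z` is the compact set where the asserted bound fails or is attained. The boundary condition
  -- excludes boundary points, so `φ` has a negative maximum on `Z`, and `-ε₀` is this maximum.
  set Z := (Icc t₁ t₂ ×ˢ (K ∩ closure Ω)) ∩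
    (fun q : ℝ × Space d => fderiv ℝ φ q.2 (V q.1 q.2)) ⁻¹' Ici (G * Cb + δ) with hZ
  have hZc : IsCompact Z :=
    hcpt.of_isClosed_subset (hfd.preimage_isClosed_of_isClosed hcpt.isClosed isClosed_Ici)
      inter_subset_left
  have hneg : ∀ q ∈ Z, φ q.2 < 0 := by
    rintro ⟨t, y⟩ ⟨⟨ht, hyK, hyc⟩, hq⟩
    by_contra hn
    have hyΩ : y ∉ Ω := fun hy => hn ((h.mem_iff y (hKball hyK)).1 hy)
    have hyf : y ∈ frontier Ω := by rw [hΩ.frontier_eq]; exact ⟨hyc, hyΩ⟩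
    have hb := hbd t ht y hyf _ ⟨φ, h.isLocalDefiningFunction (hKball hyK), rfl⟩
    have hg : 0 < ‖gradient φ y‖ := norm_pos_iff.2 (h.gradient_ne_zero (hKball hyK))
    rw [inner_smul_right, real_inner_comm, inner_gradient_left, inv_mul_le_iff₀ hg] at hb
    have := mul_le_mul_of_nonneg_right (hG y hyK) hCb
    simp only [mem_preimage, mem_Ici] at hq
    linarith
  have hφZ : ContinuousOn (fun q : ℝ × Space d => φ q.2) Z :=
    h.continuousOn.comp continuousOn_snd fun q hq => hKball hq.1.2.1
  rcases Z.eq_empty_or_nonempty with hemp | hne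
  · refine ⟨1, one_pos, fun t ht y hy _ => ?_⟩
    by_contra hlt
    have : (t, y) ∈ Z := ⟨⟨ht, hy.1, subset_closure hy.2⟩, (not_le.1 hlt).le⟩
    rw [hemp] at this
    exact this
  · obtain ⟨q, hq, hmax⟩ := hZc.exists_isMaxOn hne hφZ
    refine ⟨-φ q.2, by linarith [hneg q hq], fun t ht y hy hlt => ?_⟩
    by_contra hgt
    have : (t, y) ∈ Z := ⟨⟨ht, hy.1, subset_closure hy.2⟩, (not_le.1 hgt).le⟩
    have hle : φ y ≤ φ q.2 := hmax this
    linarith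

end IsBoundaryChart

/-! ### Cutting off near the boundary -/

/-- A smooth transition from `0` on `(-∞, 1]` to `1` on `[2, ∞)`. -/
def ramp (s : ℝ) : ℝ := Real.smoothTransition (s - 1)

theorem contDiff_ramp : ContDiff ℝ 1 ramp :=
  (Real.smoothTransition.contDiff (n := 1)).comp (contDiff_id.sub contDiff_const)

theorem ramp_nonneg (s : ℝ) : 0 ≤ ramp s := Real.smoothTransition.nonneg _

theorem ramp_le_one (s : ℝ) : ramp s ≤ 1 := Real.smoothTransition.le_one _

theorem ramp_eq_zero {s : ℝ} (hs : s ≤ 1) : ramp s = 0 :=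
  Real.smoothTransition.zero_of_nonpos (by linarith)

theorem ramp_eq_one {s : ℝ} (hs : 2 ≤ s) : ramp s = 1 :=
  Real.smoothTransition.one_of_one_le (by linarith)

theorem deriv_ramp_nonneg (s : ℝ) : 0 ≤ deriv ramp s :=
  Monotone.deriv_nonneg fun _ _ h => Real.smoothTransition.monotone (by linarith)

theorem deriv_ramp_eq_zero {s : ℝ} (hs : 2 < s) : deriv ramp s = 0 := by
  have : ramp =ᶠ[𝓝 s] fun _ => 1 := by
    filter_upwards [lt_mem_nhds hs] with y hy using ramp_eq_one hy.le
  rw [this.deriv_eq, deriv_const]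

theorem exists_deriv_ramp_le : ∃ L, 0 ≤ L ∧ ∀ s, deriv ramp s ≤ L := by
  have hc : Continuous (deriv ramp) := contDiff_ramp.continuous_deriv le_rfl
  have hs : HasCompactSupport (deriv ramp) := by
    refine HasCompactSupport.intro (isCompact_Icc (a := (1 : ℝ)) (b := 2)) fun s hs => ?_
    rcases lt_or_ge s 1 with h | h
    · have : ramp =ᶠ[𝓝 s] fun _ => 0 := by
        filter_upwards [gt_mem_nhds h] with y hy using ramp_eq_zero hy.le
      rw [this.deriv_eq, deriv_const]
    · exact deriv_ramp_eq_zero (by by_contra h2; exact hs ⟨h, not_lt.1 h2⟩)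
  obtain ⟨L, hL⟩ := hs.exists_bound_of_continuous hc
  exact ⟨L, (norm_nonneg _).trans (hL 0), fun s => (le_abs_self _).trans (hL s)⟩

/-- The function `ψ` cut off in an `ε`-neighbourhood of the zero set of `φ`. -/
def cutPiece (ψ φ : Space d → ℝ) (ε : ℝ) (y : Space d) : ℝ := ψ y * ramp (-φ y / ε)

section cutPiece

variable {Ω : Set (Space d)} {x : Space d} {r : ℝ} {φ ψ : Space d → ℝ} {v : Space d} {c ε : ℝ}

theorem tsupport_cutPiece_subset_left : tsupport (cutPiece ψ φ ε) ⊆ tsupport ψ :=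
  closure_mono fun y hy => by
    rw [Function.mem_support, cutPiece] at hy
    exact left_ne_zero_of_mul hy

theorem tsupport_cutPiece_subset (h : IsBoundaryChart Ω x r φ v c)
    (hψ : tsupport ψ ⊆ Metric.ball x r) (hε : 0 < ε) : tsupport (cutPiece ψ φ ε) ⊆ Ω := by
  intro y hy
  have hyb := hψ (tsupport_cutPiece_subset_left hy)
  rw [h.mem_iff y hyb]
  by_contra hn
  have hev : ∀ᶠ z in 𝓝 y, -ε < φ z :=
    (h.contDiffAt y hyb).continuousAt.eventually (lt_mem_nhds (by linarith))
  refine notMem_tsupport_iff_eventuallyEq.2 ?_ hy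
  filter_upwards [hev] with z hz
  rw [cutPiece, ramp_eq_zero, mul_zero, Pi.zero_apply]
  rw [div_le_one hε]; linarith

theorem hasFDerivAt_cutPiece (h : IsBoundaryChart Ω x r φ v c) (hψ1 : ContDiff ℝ 1 ψ)
    {y : Space d} (hy : y ∈ Metric.ball x r) :
    HasFDerivAt (cutPiece ψ φ ε) (ψ y • (deriv ramp (-φ y / ε) • (-(ε⁻¹) • fderiv ℝ φ y))
      + ramp (-φ y / ε) • fderiv ℝ ψ y) y := by
  have h1 : HasFDerivAt φ (fderiv ℝ φ y) y :=
    ((h.contDiffAt y hy).differentiableAt one_ne_zero).hasFDerivAt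
  have h2 : HasFDerivAt (fun z => -φ z / ε) (-(ε⁻¹) • fderiv ℝ φ y) y := by
    refine (h1.const_mul (-(ε⁻¹))).congr_of_eventuallyEq (Eventually.of_forall fun z => ?_)
    simp only [div_eq_mul_inv]; ring
  have h3 : HasDerivAt ramp (deriv ramp (-φ y / ε)) (-φ y / ε) :=
    (contDiff_ramp.differentiable one_ne_zero _).hasDerivAt
  have h4 : HasFDerivAt ψ (fderiv ℝ ψ y) y := (hψ1.differentiable one_ne_zero y).hasFDerivAt
  have h5 : HasFDerivAt (fun z => ramp (-φ z / ε))
      (deriv ramp (-φ y / ε) • (-(ε⁻¹) • fderiv ℝ φ y)) y :=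
    HasDerivAt.comp_hasFDerivAt (h₂ := ramp) y h3 h2
  exact h4.mul h5

theorem contDiff_cutPiece (h : IsBoundaryChart Ω x r φ v c) (hψ1 : ContDiff ℝ 1 ψ)
    (hψ : tsupport ψ ⊆ Metric.ball x r) : ContDiff ℝ 1 (cutPiece ψ φ ε) := by
  rw [contDiff_iff_contDiffAt]
  intro y
  by_cases hy : y ∈ tsupport ψ
  · have h1 := h.contDiffAt y (hψ hy)
    exact hψ1.contDiffAt.mul (contDiff_ramp.contDiffAt.comp y (h1.neg.div_const ε))
  · have : cutPiece ψ φ ε =ᶠ[𝓝 y] fun _ => 0 :=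
      notMem_tsupport_iff_eventuallyEq.1 fun h' => hy (tsupport_cutPiece_subset_left h')
    exact contDiffAt_const.congr_of_eventuallyEq this

/-- Cutting off changes the derivative in the collar only, and there in the normal direction. -/
theorem fderiv_sub_fderiv_cutPiece_le (h : IsBoundaryChart Ω x r φ v c) (hψ1 : ContDiff ℝ 1 ψ)
    (hψ : tsupport ψ ⊆ Metric.ball x r) (hψ0 : ∀ y, 0 ≤ ψ y) (hψle : ∀ y, ψ y ≤ 1) (hε : 0 < ε)
    {L B N : ℝ} (hL : ∀ s, deriv ramp s ≤ L) {y u : Space d} (hyΩ : y ∈ Ω)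
    (hB : ‖fderiv ℝ ψ y‖ * ‖u‖ ≤ B) (hB0 : 0 ≤ B) (hN : 0 ≤ N) (hL0 : 0 ≤ L)
    (hu : y ∈ tsupport ψ → -(3 * ε) < φ y → fderiv ℝ φ y u ≤ N) :
    fderiv ℝ ψ y u - fderiv ℝ (cutPiece ψ φ ε) y u ≤
      (Metric.ball x r ∩ φ ⁻¹' Ioo (-(3 * ε)) 0).indicator (fun _ => B + L * N / ε) y := by
  have hbound : 0 ≤ B + L * N / ε := by positivity
  by_cases hy : y ∈ tsupport ψ
  · have hyb := hψ hy
    rw [(hasFDerivAt_cutPiece h hψ1 hyb).fderiv]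
    simp only [add_apply, smul_apply, smul_eq_mul]
    -- The difference is `(1 - ramp) Dψ u + ψ ramp' Dφ u / ε`. As `ψ ramp' ≥ 0`, an upper bound on
    -- `Dφ u` suffices. For `φ ≤ -3 ε` the argument of `ramp` is beyond `2`, where `ramp` is locally
    -- constant.
    by_cases hφ : -(3 * ε) < φ y
    · have hmem : y ∈ Metric.ball x r ∩ φ ⁻¹' Ioo (-(3 * ε)) 0 :=
        ⟨hyb, hφ, (h.mem_iff y hyb).1 hyΩ⟩
      rw [indicator_of_mem hmem]
      have h1 : (1 - ramp (-φ y / ε)) * fderiv ℝ ψ y u ≤ B := by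
        have h2 : |fderiv ℝ ψ y u| ≤ B := ((fderiv ℝ ψ y).le_opNorm u).trans hB
        have h3 := ramp_nonneg (-φ y / ε)
        have h4 := ramp_le_one (-φ y / ε)
        calc _ ≤ (1 - ramp (-φ y / ε)) * B :=
              mul_le_mul_of_nonneg_left ((le_abs_self _).trans h2) (by linarith)
          _ ≤ B := by nlinarith
      have h5 : ψ y * (deriv ramp (-φ y / ε) * (ε⁻¹ * fderiv ℝ φ y u)) ≤ L * N / ε := by
        have h6 : 0 ≤ ψ y * deriv ramp (-φ y / ε) := mul_nonneg (hψ0 y) (deriv_ramp_nonneg _)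
        have h7 : ψ y * deriv ramp (-φ y / ε) ≤ L :=
          (mul_le_of_le_one_left (deriv_ramp_nonneg _) (hψle y)).trans (hL _)
        calc _ = ψ y * deriv ramp (-φ y / ε) * (ε⁻¹ * fderiv ℝ φ y u) := by ring
          _ ≤ ψ y * deriv ramp (-φ y / ε) * (ε⁻¹ * N) :=
              mul_le_mul_of_nonneg_left
                (mul_le_mul_of_nonneg_left (hu hy hφ) (inv_nonneg.2 hε.le)) h6
          _ ≤ L * (ε⁻¹ * N) := mul_le_mul_of_nonneg_right h7 (by positivity)
          _ = _ := by rw [div_eq_mul_inv]; ring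
      linarith
    · have h3 : 2 < -φ y / ε := by rw [lt_div_iff₀ hε]; linarith
      rw [deriv_ramp_eq_zero h3, ramp_eq_one h3.le]
      simpa using indicator_nonneg (fun _ _ => hbound) y
  · have h1 : ψ =ᶠ[𝓝 y] fun _ => 0 := notMem_tsupport_iff_eventuallyEq.1 hy
    have h2 : cutPiece ψ φ ε =ᶠ[𝓝 y] fun _ => 0 :=
      notMem_tsupport_iff_eventuallyEq.1 fun h' => hy (tsupport_cutPiece_subset_left h')
    rw [h1.fderiv_eq, h2.fderiv_eq]
    simpa using indicator_nonneg (fun _ _ => hbound) y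

end cutPiece

end TridiagRD

/-! ### Global cutoff functions of the domain -/

namespace TridiagRD

variable {d : ℕ}

/-- A partition of unity of `closure Ω` subordinate to `Ω` and finitely many boundary charts. -/
theorem IsBoundedC1Domain.exists_partition {Ω : Set (Space d)} (hΩ : IsBoundedC1Domain Ω) :
    ∃ (s : Finset (Space d)) (r : s → ℝ) (φ : s → Space d → ℝ) (v : s → Space d) (c : s → ℝ)
      (ψ : Option s → Space d → ℝ),
      (∀ i : s, IsBoundaryChart Ω i (r i) (φ i) (v i) (c i)) ∧ (∀ j, ContDiff ℝ 1 (ψ j)) ∧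
      tsupport (ψ none) ⊆ Ω ∧ (∀ i : s, tsupport (ψ (some i)) ⊆ Metric.ball i (r i)) ∧
      (∀ j x, 0 ≤ ψ j x) ∧ (∀ x, ∑ j, ψ j x ≤ 1) ∧ ∀ x ∈ Ω, ∑ j, ψ j x = 1 := by
  have hfc : IsCompact (frontier Ω) :=
    hΩ.isBounded.isCompact_closure.of_isClosed_subset isClosed_frontier frontier_subset_closure
  have hch : ∀ x : Space d, ∃ r φ v c, x ∈ frontier Ω → IsBoundaryChart Ω x r φ v c := by
    intro x
    by_cases hx : x ∈ frontier Ω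
    · obtain ⟨φ, hφ⟩ := hΩ.boundary x hx
      obtain ⟨r, v, c, h⟩ := hφ.exists_isBoundaryChart
      exact ⟨r, φ, v, c, fun _ => h⟩
    · exact ⟨0, 0, 0, 0, fun h => absurd h hx⟩
  choose r φ v c hchart using hch
  obtain ⟨s, hs, hcov⟩ := hfc.elim_nhds_subcover (fun x => Metric.ball x (r x))
    fun x hx => Metric.ball_mem_nhds x (hchart x hx).radius_pos
  -- The index `none` stands for the interior piece, which needs no cutting.
  let U : Option s → Set (Space d) := fun j => j.elim Ω fun i => Metric.ball i (r i)
  have hU : ∀ j, IsOpen (U j) := by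
    rintro (_ | i)
    · exact hΩ.isOpen
    · exact Metric.isOpen_ball
  have hUcov : closure Ω ⊆ ⋃ j, U j := by
    intro x hx
    by_cases hxΩ : x ∈ Ω
    · exact mem_iUnion.2 ⟨none, hxΩ⟩
    · have hxf : x ∈ frontier Ω := by rw [hΩ.isOpen.frontier_eq]; exact ⟨hx, hxΩ⟩
      obtain ⟨i, hi, hxi⟩ := mem_iUnion₂.1 (hcov hxf)
      exact mem_iUnion.2 ⟨some ⟨i, hi⟩, hxi⟩
  obtain ⟨f, hf⟩ := SmoothPartitionOfUnity.exists_isSubordinate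
    (modelWithCornersSelf ℝ (Space d)) isClosed_closure U hU hUcov
  refine ⟨s, fun i => r i, fun i => φ i, fun i => v i, fun i => c i, fun j => f j,
    fun i => hchart i (hs i i.2), fun j => ?_, hf none, fun i => hf (some i),
    fun j x => f.nonneg j x, fun x => ?_, fun x hx => ?_⟩
  · exact (f j).contMDiff.contDiff.of_le (by exact_mod_cast le_top)
  · have := f.sum_le_one x
    rwa [finsum_eq_sum_of_fintype] at this
  · have := f.sum_eq_one (subset_closure hx)
    rwa [finsum_eq_sum_of_fintype] at this

/-- Cutoff functions of a bounded `C¹` domain. Tested against a vector field whose normal component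
on the boundary is at most `Cb`, their gradients are bounded below by a multiple of `-Cb`, up to a
small error. -/
theorem IsBoundedC1Domain.exists_cutoff {Ω : Set (Space d)} (hΩ : IsBoundedC1Domain Ω) :
    ∃ A : ℝ, 0 ≤ A ∧ ∃ χ : ℕ → Space d → ℝ,
      (∀ n, ContDiff ℝ 1 (χ n)) ∧ (∀ n, tsupport (χ n) ⊆ Ω) ∧ (∀ n x, 0 ≤ χ n x) ∧
      (∀ n x, χ n x ≤ 1) ∧ (∀ x ∈ Ω, Tendsto (fun n => χ n x) atTop (𝓝 1)) ∧
      ∀ (t₁ t₂ Cb δ : ℝ) (V : ℝ → Space d → Space d), 0 ≤ Cb → 0 < δ →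
        ContinuousOn (fun q : ℝ × Space d => V q.1 q.2) (Icc t₁ t₂ ×ˢ closure Ω) →
        (∀ t ∈ Icc t₁ t₂, ∀ y ∈ frontier Ω, ∀ η, IsOutwardUnitNormal Ω y η →
          inner ℝ (V t y) η ≤ Cb) →
        ∀ᶠ n in atTop, ∀ t ∈ Icc t₁ t₂,
          -∫ x in Ω, fderiv ℝ (χ n) x (V t x) ≤ A * Cb + δ := by
  obtain ⟨s, r, φ, v, c, ψ, hchart, hψ1, hψnone, hψsome, hψ0, hψle, hψsum⟩ := hΩ.exists_partition
  obtain ⟨L, hL0, hL⟩ := exists_deriv_ramp_le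
  choose C hC0 hC using fun i => (hchart i).exists_volume_collar_le
  have hKcpt : ∀ i : s, IsCompact (tsupport (ψ (some i))) := fun i =>
    (isCompact_closedBall (i : Space d) (r i)).of_isClosed_subset (isClosed_tsupport _)
      ((hψsome i).trans Metric.ball_subset_closedBall)
  have hGex : ∀ i : s, ∃ G, 0 ≤ G ∧ ∀ y ∈ tsupport (ψ (some i)), ‖gradient (φ i) y‖ ≤ G := by
    intro i
    have hcont : ContinuousOn (fun y => fderiv ℝ (φ i) y) (tsupport (ψ (some i))) := fun y hy =>
      (((hchart i).contDiffAt y (hψsome i hy)).continuousAt_fderiv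
        one_ne_zero).continuousWithinAt
    obtain ⟨G, hG⟩ := (hKcpt i).exists_bound_of_continuousOn hcont
    refine ⟨max G 0, le_max_right _ _, fun y hy => ?_⟩
    rw [gradient, LinearIsometryEquiv.norm_map]
    exact (hG y hy).trans (le_max_left _ _)
  choose G hG0 hG using hGex
  have hψle1 : ∀ j x, ψ j x ≤ 1 := fun j x =>
    (Finset.single_le_sum (fun j _ => hψ0 j x) (Finset.mem_univ j)).trans (hψle x)
  let ε : ℕ → ℝ := fun n => 1 / ((n : ℝ) + 1)
  have hε : ∀ n, 0 < ε n := fun n => Nat.one_div_pos_of_nat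
  have hεlim : Tendsto ε atTop (𝓝 0) := tendsto_one_div_add_atTop_nhds_zero_nat
  let χ : ℕ → Space d → ℝ := fun n x => ψ none x + ∑ i, cutPiece (ψ (some i)) (φ i) (ε n) x
  have hχ1 : ∀ n, ContDiff ℝ 1 (χ n) := fun n =>
    (hψ1 none).add (ContDiff.sum fun i _ => contDiff_cutPiece (hchart i) (hψ1 _) (hψsome i))
  have hpiece0 : ∀ n i x, 0 ≤ cutPiece (ψ (some i)) (φ i) (ε n) x := fun n i x =>
    mul_nonneg (hψ0 _ x) (ramp_nonneg _)
  have hpiecele : ∀ n i x, cutPiece (ψ (some i)) (φ i) (ε n) x ≤ ψ (some i) x := fun n i x =>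
    mul_le_of_le_one_right (hψ0 _ x) (ramp_le_one _)
  have hχsupp : ∀ n, tsupport (χ n) ⊆ Ω := by
    intro n x hx
    by_contra hxΩ
    refine notMem_tsupport_iff_eventuallyEq.2 ?_ hx
    have h1 : ∀ᶠ y in 𝓝 x, ψ none y = 0 :=
      notMem_tsupport_iff_eventuallyEq.1 fun h => hxΩ (hψnone h)
    have h2 : ∀ᶠ y in 𝓝 x, ∀ i, cutPiece (ψ (some i)) (φ i) (ε n) y = 0 := by
      rw [eventually_all]
      exact fun i => notMem_tsupport_iff_eventuallyEq.1 fun h =>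
        hxΩ (tsupport_cutPiece_subset (hchart i) (hψsome i) (hε n) h)
    filter_upwards [h1, h2] with y hy1 hy2
    simp [χ, hy1, hy2]
  have hχlim : ∀ x ∈ Ω, Tendsto (fun n => χ n x) atTop (𝓝 1) := by
    intro x hx
    rw [← hψsum x hx, Fintype.sum_option]
    refine tendsto_const_nhds.add (tendsto_finsetSum _ fun i _ => ?_)
    by_cases hxi : x ∈ tsupport (ψ (some i))
    · have hneg := ((hchart i).mem_iff x (hψsome i hxi)).1 hx
      refine tendsto_const_nhds.congr' ?_
      have : ∀ᶠ n in atTop, ε n < -φ i x / 2 := hεlim.eventually (gt_mem_nhds (by linarith))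
      filter_upwards [this] with n hn
      rw [cutPiece, ramp_eq_one, mul_one]
      rw [le_div_iff₀ (hε n)]
      linarith
    · have h0 : ψ (some i) x = 0 := image_eq_zero_of_notMem_tsupport hxi
      simp [cutPiece, h0]
  -- The collar of width `3 ε` has volume at most `C i * 3 * ε`, which cancels the factor `1 / ε` in
  -- `L * (G i * Cb) / ε`.
  refine ⟨∑ i, C i * 3 * (L * G i), Finset.sum_nonneg fun i _ => ?_, χ, hχ1, hχsupp,
    ?_, ?_, hχlim, ?_⟩
  · exact mul_nonneg (mul_nonneg (hC0 i) (by norm_num)) (mul_nonneg hL0 (hG0 i))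
  · exact fun n x => add_nonneg (hψ0 _ x) (Finset.sum_nonneg fun i _ => hpiece0 n i x)
  · intro n x
    refine le_trans ?_ (hψle x)
    rw [Fintype.sum_option]
    exact add_le_add le_rfl (Finset.sum_le_sum fun i _ => hpiecele n i x)
  intro t₁ t₂ Cb δ V hCb hδ hV hbd
  set R := ∑ i, C i * 3 * L with hR
  have hR0 : 0 ≤ R := Finset.sum_nonneg fun i _ => mul_nonneg (mul_nonneg (hC0 i) (by norm_num)) hL0
  -- Half of `δ` absorbs the excess `R * δ'` of the normal component near the boundary, the other
  -- half the term `Q * ε n` from the derivatives of the partition functions.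
  set δ' := δ / (2 * (R + 1)) with hδ'
  have hδ'0 : 0 < δ' := by positivity
  have hcl : IsCompact (closure Ω) := hΩ.isBounded.isCompact_closure
  obtain ⟨M, hM⟩ := (isCompact_Icc.prod hcl).exists_bound_of_continuousOn hV
  have hM0 : 0 ≤ max M 0 := le_max_right _ _
  have hDψ : ∀ i : s, ∃ B, 0 ≤ B ∧ ∀ y, ‖fderiv ℝ (ψ (some i)) y‖ ≤ B := by
    intro i
    have hcs : HasCompactSupport (fderiv ℝ (ψ (some i))) :=
      HasCompactSupport.fderiv ℝ (hKcpt i)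
    obtain ⟨B, hB⟩ := hcs.exists_bound_of_continuous ((hψ1 (some i)).continuous_fderiv one_ne_zero)
    exact ⟨B, (norm_nonneg _).trans (hB 0), hB⟩
  choose B hB0 hB using hDψ
  choose ε₀ hε₀ hnormal using fun i : s =>
    (hchart i).exists_fderiv_apply_le hΩ.isOpen (hKcpt i) (hψsome i) (hG i) hCb hδ'0 hV hbd
  set Q := ∑ i, C i * 3 * (B i * max M 0) with hQ
  have hev1 : ∀ᶠ n in atTop, ∀ i, ε n < ε₀ i / 3 := by
    rw [eventually_all]
    exact fun i => hεlim.eventually (gt_mem_nhds (by linarith [hε₀ i]))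
  have hev2 : ∀ᶠ n in atTop, Q * ε n < δ / 2 := by
    have : Tendsto (fun n => Q * ε n) atTop (𝓝 (Q * 0)) := hεlim.const_mul Q
    rw [mul_zero] at this
    exact this.eventually (gt_mem_nhds (by linarith))
  filter_upwards [hev1, hev2] with n hn1 hn2 t ht
  let S : s → Set (Space d) := fun i => Metric.ball (i : Space d) (r i) ∩ φ i ⁻¹' Ioo (-(3 * ε n)) 0
  let N : s → ℝ := fun i => B i * max M 0 + L * (G i * Cb + δ') / ε n
  have hSmeas : ∀ i, MeasurableSet (S i) := fun i => ((hchart i).isOpen_collar _).measurableSet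
  have hSfin : ∀ i, volume (S i) ≠ ∞ := fun i =>
    ((measure_mono inter_subset_left).trans_lt measure_ball_lt_top).ne
  have hN0 : ∀ i, 0 ≤ N i := fun i => by
    have h1 := hB0 i
    have h2 := mul_nonneg (hG0 i) hCb
    have h3 := hε n
    have h4 : 0 ≤ G i * Cb + δ' := by linarith
    positivity
  have hpt : ∀ x ∈ Ω, -fderiv ℝ (χ n) x (V t x) ≤ ∑ i, (S i).indicator (fun _ => N i) x := by
    intro x hx
    -- Since the partition functions sum to `1` near `x`, `-Dχ` is the sum of the differences
    -- between uncut and cut pieces.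
    have hsum0 : fderiv ℝ (fun y => ∑ j, ψ j y) x = 0 := by
      have : (fun y => ∑ j, ψ j y) =ᶠ[𝓝 x] fun _ => 1 := by
        filter_upwards [hΩ.isOpen.mem_nhds hx] with y hy using hψsum y hy
      rw [this.fderiv_eq]
      simp
    rw [fderiv_fun_sum fun j _ => (hψ1 j).differentiable one_ne_zero x, Fintype.sum_option] at hsum0
    have hχd : fderiv ℝ (χ n) x = fderiv ℝ (ψ none) x
        + ∑ i, fderiv ℝ (cutPiece (ψ (some i)) (φ i) (ε n)) x := by
      have hd : ∀ i ∈ Finset.univ, DifferentiableAt ℝ (cutPiece (ψ (some i)) (φ i) (ε n)) x :=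
        fun i _ => (contDiff_cutPiece (hchart i) (hψ1 _) (hψsome i)).differentiable one_ne_zero x
      rw [← fderiv_fun_sum hd]
      exact fderiv_fun_add ((hψ1 none).differentiable one_ne_zero x) (DifferentiableAt.fun_sum hd)
    have hkey : -fderiv ℝ (χ n) x (V t x) = ∑ i, (fderiv ℝ (ψ (some i)) x (V t x)
        - fderiv ℝ (cutPiece (ψ (some i)) (φ i) (ε n)) x (V t x)) := by
      have h1 := congrArg (fun f : Space d →L[ℝ] ℝ => f (V t x)) hsum0
      simp only [add_apply, sum_apply, zero_apply] at h1
      rw [hχd, Finset.sum_sub_distrib]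
      simp only [add_apply, sum_apply]
      linarith
    rw [hkey]
    refine Finset.sum_le_sum fun i _ => ?_
    have hVx : ‖V t x‖ ≤ max M 0 :=
      (hM (t, x) ⟨ht, subset_closure hx⟩).trans (le_max_left _ _)
    refine fderiv_sub_fderiv_cutPiece_le (hchart i) (hψ1 _) (hψsome i) (hψ0 _) (hψle1 _) (hε n) hL
      hx (mul_le_mul (hB i x) hVx (norm_nonneg _) (hB0 i)) (mul_nonneg (hB0 i) hM0)
      (add_nonneg (mul_nonneg (hG0 i) hCb) hδ'0.le) hL0 fun hxi hφx => ?_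
    exact hnormal i t ht x ⟨hxi, hx⟩ (by linarith [hn1 i])
  have hVt : ContinuousOn (V t) (closure Ω) :=
    hV.comp (f := fun x => (t, x)) (by fun_prop) fun x hx => ⟨ht, hx⟩
  have hint : IntegrableOn (fun x => fderiv ℝ (χ n) x (V t x)) Ω :=
    ((((hχ1 n).continuous_fderiv one_ne_zero).continuousOn.clm_apply hVt).integrableOn_compact
      hcl).mono_set subset_closure
  have hindint : ∀ i, Integrable ((S i).indicator fun _ => N i) (volume.restrict Ω) := fun i =>
    ((integrable_indicator_iff (hSmeas i)).2 (integrableOn_const (hSfin i))).restrict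
  have hstep : -∫ x in Ω, fderiv ℝ (χ n) x (V t x) ≤ ∑ i, N i * (C i * (3 * ε n)) := by
    rw [← integral_neg]
    calc ∫ x in Ω, -fderiv ℝ (χ n) x (V t x)
        ≤ ∫ x in Ω, ∑ i, (S i).indicator (fun _ => N i) x :=
          setIntegral_mono_on hint.neg (integrable_finsetSum _ fun i _ => hindint i)
            hΩ.isOpen.measurableSet hpt
      _ = ∑ i, ∫ x in Ω, (S i).indicator (fun _ => N i) x :=
          integral_finsetSum _ fun i _ => hindint i
      _ ≤ ∑ i, N i * (C i * (3 * ε n)) := by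
          refine Finset.sum_le_sum fun i _ => ?_
          rw [integral_indicator_const _ (hSmeas i), smul_eq_mul, mul_comm]
          refine mul_le_mul_of_nonneg_left ?_ (hN0 i)
          refine le_trans ?_ (hC i (3 * ε n) (by linarith [hε n]))
          rw [measureReal_restrict_apply (hSmeas i)]
          exact measureReal_mono inter_subset_left (hSfin i)
  refine hstep.trans ?_
  have hval : ∑ i, N i * (C i * (3 * ε n))
      = (∑ i, C i * 3 * (L * G i)) * Cb + R * δ' + Q * ε n := by
    rw [hR, hQ, Finset.sum_mul, Finset.sum_mul, Finset.sum_mul, ← Finset.sum_add_distrib,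
      ← Finset.sum_add_distrib]
    refine Finset.sum_congr rfl fun i _ => ?_
    have := (hε n).ne'
    simp only [N]
    field_simp
    ring
  rw [hval]
  have : R * δ' ≤ δ / 2 := by
    rw [hδ', mul_div_assoc', div_le_div_iff₀ (by positivity) (by norm_num)]
    nlinarith
  linarith

end TridiagRD

/-! ### Integration by parts against a cutoff -/

namespace TridiagRD

variable {d m : ℕ}

/-- `H` is of class `C²` with first partial derivatives `H₁` and second partial derivatives `H₂`. -/
structure HasPartials (H : (Fin m → ℝ) → ℝ) (H₁ : (Fin m → ℝ) → Fin m → ℝ)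
    (H₂ : (Fin m → ℝ) → Fin m → Fin m → ℝ) : Prop where
  first : ∀ W, HasFDerivAt H (coordForm (H₁ W)) W
  second : ∀ j W, HasFDerivAt (fun W => H₁ W j) (coordForm (H₂ W j)) W
  continuous_second : ∀ j k, Continuous fun W => H₂ W j k

theorem continuous_coordForm {X : Type*} [TopologicalSpace X] {c : X → Fin m → ℝ}
    (hc : ∀ j, Continuous fun x => c x j) : Continuous fun x => coordForm (c x) := by
  unfold coordForm
  exact continuous_finsetSum _ fun j _ => (hc j).smul continuous_const

namespace HasPartials

variable {H : (Fin m → ℝ) → ℝ} {H₁ : (Fin m → ℝ) → Fin m → ℝ}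
  {H₂ : (Fin m → ℝ) → Fin m → Fin m → ℝ}

theorem continuous (h : HasPartials H H₁ H₂) : Continuous H :=
  continuous_iff_continuousAt.2 fun W => (h.first W).continuousAt

theorem contDiff_first (h : HasPartials H H₁ H₂) (j : Fin m) :
    ContDiff ℝ 1 fun W => H₁ W j := by
  rw [contDiff_one_iff_fderiv]
  refine ⟨fun W => (h.second j W).differentiableAt, ?_⟩
  have : fderiv ℝ (fun W => H₁ W j) = fun W => coordForm (H₂ W j) :=
    funext fun W => (h.second j W).fderiv
  rw [this]
  exact continuous_coordForm (h.continuous_second j)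

theorem continuous_first (h : HasPartials H H₁ H₂) (j : Fin m) : Continuous fun W => H₁ W j :=
  (h.contDiff_first j).continuous

end HasPartials

/-- Compact support inside `Ω` lets functions that are regular only in `Ω` be treated as functions
on the whole space. -/
theorem continuous_mul_of_tsupport_subset {Ω : Set (Space d)} (hΩ : IsOpen Ω) {χ f : Space d → ℝ}
    (hχ : Continuous χ) (hsupp : tsupport χ ⊆ Ω) (hf : ContinuousOn f Ω) :
    Continuous fun x => χ x * f x := by
  rw [continuous_iff_continuousAt]
  intro x
  by_cases hx : x ∈ Ω
  · exact hχ.continuousAt.mul (hf.continuousAt (hΩ.mem_nhds hx))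
  · have h0 : χ =ᶠ[𝓝 x] 0 := notMem_tsupport_iff_eventuallyEq.1 fun h => hx (hsupp h)
    have : (fun x => χ x * f x) =ᶠ[𝓝 x] fun _ => 0 := by
      filter_upwards [h0] with y hy
      simp [hy]
    exact continuousAt_const.congr this.symm

theorem integrable_mul_of_tsupport_subset {Ω : Set (Space d)} (hΩ : IsOpen Ω) {χ f : Space d → ℝ}
    (hχ : Continuous χ) (hcpt : HasCompactSupport χ) (hsupp : tsupport χ ⊆ Ω)
    (hf : ContinuousOn f Ω) : Integrable fun x => χ x * f x :=
  (continuous_mul_of_tsupport_subset hΩ hχ hsupp hf).integrable_of_hasCompactSupport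
    hcpt.mul_right

/-- Integration by parts against a cutoff function, where the second order terms have a sign. -/
theorem integral_laplacian_le {Ω : Set (Space d)} (hΩ : IsOpen Ω) {u : Space d → Fin m → ℝ}
    (hu : ∀ j, ContDiffOn ℝ 2 (fun x => u x j) Ω) {g : Space d → Fin m → Space d}
    (hg : ∀ x ∈ Ω, ∀ j, HasGradientAt (fun y => u y j) (g x j) x)
    {H : (Fin m → ℝ) → ℝ} {H₁ : (Fin m → ℝ) → Fin m → ℝ} {H₂ : (Fin m → ℝ) → Fin m → Fin m → ℝ}
    (hH : HasPartials H H₁ H₂) {lam : Fin m → ℝ}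
    (hquad : ∀ x ∈ Ω, ∀ ξ : Fin m → ℝ,
      0 ≤ ∑ i, ∑ j, lam i * H₂ (u x) i j * (ξ i * ξ j))
    {χ : Space d → ℝ} (hχ : ContDiff ℝ 1 χ) (hcpt : HasCompactSupport χ)
    (hsupp : tsupport χ ⊆ Ω) (hχ0 : ∀ x, 0 ≤ χ x) :
    ∫ x in Ω, χ x * ∑ j, lam j * H₁ (u x) j * Laplacian.laplacian (fun y => u y j) x ≤
      -∫ x in Ω, fderiv ℝ χ x (∑ j, (lam j * H₁ (u x) j) • g x j) := by
  let b := EuclideanSpace.basisFun (Fin d) ℝ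
  let P : Fin d → Space d → ℝ := fun e x =>
    ∑ j, lam j * H₁ (u x) j * fderiv ℝ (fun y => u y j) x (b e)
  have hD1 : ∀ j, ContDiffOn ℝ 1 (fun x => fderiv ℝ (fun y => u y j) x) Ω := fun j =>
    (hu j).fderiv_of_isOpen hΩ (by norm_num)
  have hu1 : ContDiffOn ℝ 1 u Ω := contDiffOn_pi.2 fun j => (hu j).of_le (by norm_num)
  have hH1u : ∀ j, ContDiffOn ℝ 1 (fun x => H₁ (u x) j) Ω := fun j =>
    (hH.contDiff_first j).comp_contDiffOn hu1
  have hP1 : ∀ e, ContDiffOn ℝ 1 (P e) Ω := fun e =>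
    ContDiffOn.sum fun j _ => (contDiffOn_const.mul (hH1u j)).mul
      ((hD1 j).clm_apply contDiffOn_const)
  -- The second sum is the Hessian form at `ξ_i = ∂_e u_i`; its sign allows it to be dropped.
  have hPd : ∀ e, ∀ x ∈ Ω, fderiv ℝ (P e) x (b e) =
      ∑ j, lam j * H₁ (u x) j * fderiv ℝ (fderiv ℝ (fun y => u y j)) x (b e) (b e) +
      ∑ i, ∑ j, lam i * H₂ (u x) i j *
        (fderiv ℝ (fun y => u y i) x (b e) * fderiv ℝ (fun y => u y j) x (b e)) := by
    intro e x hx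
    have hnhds := hΩ.mem_nhds hx
    have hud : HasFDerivAt u (ContinuousLinearMap.pi fun j => fderiv ℝ (fun y => u y j) x) x :=
      hasFDerivAt_pi.2 fun j =>
        (((hu j).contDiffAt hnhds).differentiableAt (by norm_num)).hasFDerivAt
    have hD2 : ∀ j, HasFDerivAt (fun y => fderiv ℝ (fun z => u z j) y (b e))
        ((fderiv ℝ (fderiv ℝ (fun y => u y j)) x).flip (b e)) x := fun j =>
      ((((hD1 j).contDiffAt hnhds).differentiableAt one_ne_zero).hasFDerivAt.clm_apply
        (hasFDerivAt_const (b e) x)).congr_fderiv (by simp)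
    have hH1d : ∀ j, HasFDerivAt (fun y => H₁ (u y) j)
        ((coordForm (H₂ (u x) j)).comp
          (ContinuousLinearMap.pi fun j => fderiv ℝ (fun y => u y j) x)) x := fun j =>
      HasFDerivAt.comp x (hH.second j (u x)) hud
    have hPder : HasFDerivAt (P e) _ x :=
      HasFDerivAt.fun_sum (u := Finset.univ) fun j _ => ((hH1d j).const_mul (lam j)).mul (hD2 j)
    rw [hPder.fderiv]
    simp only [sum_apply, add_apply, smul_apply, smul_eq_mul, ContinuousLinearMap.flip_apply,
      ContinuousLinearMap.comp_apply, coordForm_apply, ContinuousLinearMap.pi_apply]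
    rw [Finset.sum_add_distrib]
    congr 1
    refine Finset.sum_congr rfl fun i _ => ?_
    rw [Finset.mul_sum, Finset.mul_sum]
    refine Finset.sum_congr rfl fun j _ => ?_
    ring
  have hlap : ∀ j x, Laplacian.laplacian (fun y => u y j) x =
      ∑ e, fderiv ℝ (fderiv ℝ (fun y => u y j)) x (b e) (b e) := by
    intro j x
    rw [InnerProductSpace.laplacian_eq_iteratedFDeriv_orthonormalBasis _ b]
    simp [iteratedFDeriv_two_apply]
  have hlapc : ∀ j, ContinuousOn (fun x => Laplacian.laplacian (fun y => u y j) x) Ω := by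
    intro j
    simp_rw [hlap]
    refine continuousOn_finsetSum _ fun e _ => ?_
    exact (((hD1 j).continuousOn_fderiv_of_isOpen hΩ le_rfl).clm_apply
      continuousOn_const).clm_apply continuousOn_const
  have hPfc : ∀ e, ContinuousOn (fun x => fderiv ℝ (P e) x (b e)) Ω := fun e =>
    ((hP1 e).continuousOn_fderiv_of_isOpen hΩ le_rfl).clm_apply continuousOn_const
  have hint1 : Integrable fun x => χ x *
      ∑ j, lam j * H₁ (u x) j * Laplacian.laplacian (fun y => u y j) x :=
    integrable_mul_of_tsupport_subset hΩ hχ.continuous hcpt hsupp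
      (continuousOn_finsetSum _ fun j _ =>
        (continuousOn_const.mul (hH1u j).continuousOn).mul (hlapc j))
  have hint2 : ∀ e, Integrable fun x => χ x * fderiv ℝ (P e) x (b e) := fun e =>
    integrable_mul_of_tsupport_subset hΩ hχ.continuous hcpt hsupp (hPfc e)
  have hχe_supp : ∀ e, tsupport (fun x => fderiv ℝ χ x (b e)) ⊆ tsupport χ := fun e =>
    tsupport_fderiv_apply_subset ℝ (b e)
  have hχec : ∀ e, Continuous fun x => fderiv ℝ χ x (b e) := fun e =>
    (hχ.continuous_fderiv one_ne_zero).clm_apply continuous_const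
  have hint3 : ∀ e, Integrable fun x => fderiv ℝ χ x (b e) * P e x := fun e =>
    integrable_mul_of_tsupport_subset hΩ (hχec e)
      (hcpt.fderiv_apply ℝ (b e)) ((hχe_supp e).trans hsupp) (hP1 e).continuousOn
  have hint4 : ∀ e, Integrable fun x => χ x * P e x := fun e =>
    integrable_mul_of_tsupport_subset hΩ hχ.continuous hcpt hsupp (hP1 e).continuousOn
  have hibp : ∀ e, ∫ x, χ x * fderiv ℝ (P e) x (b e) = -∫ x, fderiv ℝ χ x (b e) * P e x := fun e =>
    integral_mul_fderiv_eq_neg_fderiv_mul_of_integrable (hint3 e) (hint2 e) (hint4 e)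
      (fun x _ => hχ.differentiable one_ne_zero x)
      (fun x hx => ((hP1 e).contDiffAt (hΩ.mem_nhds (hsupp hx))).differentiableAt one_ne_zero)
  have hout : ∀ x, x ∉ Ω → χ x = 0 := fun x hx =>
    image_eq_zero_of_notMem_tsupport fun h => hx (hsupp h)
  have hout' : ∀ x, x ∉ Ω → fderiv ℝ χ x = 0 := fun x hx =>
    image_eq_zero_of_notMem_tsupport fun h => hx (hsupp (tsupport_fderiv_subset ℝ h))
  rw [setIntegral_eq_integral_of_forall_compl_eq_zero fun x hx => by rw [hout x hx, zero_mul],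
    setIntegral_eq_integral_of_forall_compl_eq_zero fun x hx => by rw [hout' x hx, zero_apply]]
  calc ∫ x, χ x * ∑ j, lam j * H₁ (u x) j * Laplacian.laplacian (fun y => u y j) x
      ≤ ∫ x, ∑ e, χ x * fderiv ℝ (P e) x (b e) := by
        refine integral_mono hint1 (integrable_finsetSum _ fun e _ => hint2 e) fun x => ?_
        by_cases hx : x ∈ Ω
        · simp only
          rw [← Finset.mul_sum]
          refine mul_le_mul_of_nonneg_left ?_ (hχ0 x)
          simp_rw [hlap, Finset.mul_sum]
          rw [Finset.sum_comm]
          refine Finset.sum_le_sum fun e _ => ?_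
          rw [hPd e x hx]
          have := hquad x hx fun i => fderiv ℝ (fun y => u y i) x (b e)
          linarith
        · simp [hout x hx]
    _ = ∑ e, -∫ x, fderiv ℝ χ x (b e) * P e x := by
        rw [integral_finsetSum _ fun e _ => hint2 e]
        exact Finset.sum_congr rfl fun e _ => hibp e
    _ = -∫ x, ∑ e, fderiv ℝ χ x (b e) * P e x := by
        rw [integral_finsetSum _ fun e _ => hint3 e, Finset.sum_neg_distrib]
    _ = -∫ x, fderiv ℝ χ x (∑ j, (lam j * H₁ (u x) j) • g x j) := by
        congr 1
        refine integral_congr_ae (Eventually.of_forall fun x => ?_)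
        by_cases hx : x ∈ Ω
        · simp only
          set y := ∑ j, (lam j * H₁ (u x) j) • g x j with hy
          have hPy : ∀ e, P e x = inner ℝ (b e) y := by
            intro e
            rw [hy, inner_sum]
            refine Finset.sum_congr rfl fun j _ => ?_
            have := (hg x hx j).hasFDerivAt.fderiv
            rw [this, inner_smul_right, real_inner_comm]
            simp
          conv_rhs => rw [← b.sum_repr' y]
          rw [map_sum]
          refine Finset.sum_congr rfl fun e _ => ?_
          rw [hPy e, map_smul, smul_eq_mul, mul_comm]
        · simp [hout' x hx]

end TridiagRD

/-! ### Energy inequality -/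

namespace TridiagRD

variable {d m : ℕ}

theorem isOpen_timeInterval (T : EReal) : IsOpen (timeInterval T) :=
  (isOpen_lt continuous_const continuous_id).inter
    (isOpen_lt continuous_coe_real_ereal continuous_const)

theorem Icc_subset_timeInterval {T : EReal} {t₁ t₂ : ℝ} (h₁ : 0 < t₁) (h₂ : (t₂ : EReal) < T) :
    Icc t₁ t₂ ⊆ timeInterval T := fun _ ht =>
  ⟨h₁.trans_le ht.1, lt_of_le_of_lt (EReal.coe_le_coe_iff.2 ht.2) h₂⟩

theorem continuous_gronwallBound_left (K ε x : ℝ) : Continuous fun δ => gronwallBound δ K ε x := by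
  unfold gronwallBound
  split_ifs <;> fun_prop

theorem le_gronwallBound_of_hasDerivAt {f f' : ℝ → ℝ} {K ε a b : ℝ} (hab : a ≤ b)
    (hf : ∀ x ∈ Icc a b, HasDerivAt f (f' x) x) (bound : ∀ x ∈ Icc a b, f' x ≤ K * f x + ε) :
    f b ≤ gronwallBound (f a) K ε (b - a) := by
  refine le_gronwallBound_of_liminf_deriv_right_le (f' := f')
    (fun x hx => (hf x hx).continuousAt.continuousWithinAt) (fun x hx r hr => ?_) le_rfl
    (fun x hx => bound x (Ico_subset_Icc_self hx)) b (right_mem_Icc.2 hab)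
  exact (hf x (Ico_subset_Icc_self hx)).hasDerivWithinAt.liminf_right_slope_le hr

namespace IsClassicalSolution

variable {Ω : Set (Space d)} {lam : Fin m → ℝ} {D : Set (Fin m → ℝ)}
  {F : (Fin m → ℝ) → Fin m → ℝ} {α : ℝ} {ρ : Fin m → ℝ} {w0 : Space d → Fin m → ℝ} {T : EReal}
  {w : ℝ → Space d → Fin m → ℝ}

theorem continuousOn_laplacian (hw : IsClassicalSolution Ω lam D F α ρ w0 T w) (j : Fin m) :
    ContinuousOn (fun q : ℝ × Space d => Laplacian.laplacian (fun y => w q.1 y j) q.2)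
      (timeInterval T ×ˢ Ω) := by
  simp_rw [InnerProductSpace.laplacian_eq_iteratedFDeriv_orthonormalBasis _
    (EuclideanSpace.basisFun (Fin d) ℝ)]
  refine continuousOn_finsetSum _ fun e _ => ?_
  exact (ContinuousMultilinearMap.apply ℝ (fun _ : Fin 2 => Space d) ℝ
    ![EuclideanSpace.basisFun (Fin d) ℝ e,
      EuclideanSpace.basisFun (Fin d) ℝ e]).continuous.comp_continuousOn (hw.continuousOn_hessian j)

theorem continuousOn_slice (hw : IsClassicalSolution Ω lam D F α ρ w0 T w) {t : ℝ}
    (ht : t ∈ timeInterval T) : ContinuousOn (w t) (closure Ω) :=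
  hw.continuousOn.comp (f := fun x => (t, x)) (by fun_prop) fun _ hx => ⟨ht, hx⟩

variable {H : (Fin m → ℝ) → ℝ} {H₁ : (Fin m → ℝ) → Fin m → ℝ}
  {H₂ : (Fin m → ℝ) → Fin m → Fin m → ℝ}

theorem continuousOn_integrand (hw : IsClassicalSolution Ω lam D F α ρ w0 T w)
    (hF : ContinuousOn F D) (hH : HasPartials H H₁ H₂) :
    ContinuousOn (fun q : ℝ × Space d => ∑ j, H₁ (w q.1 q.2) j *
      (lam j * Laplacian.laplacian (fun y => w q.1 y j) q.2 + F (w q.1 q.2) j))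
      (timeInterval T ×ˢ Ω) := by
  have hwc : ContinuousOn (fun q : ℝ × Space d => w q.1 q.2) (timeInterval T ×ˢ Ω) :=
    hw.continuousOn.mono (prod_mono_right subset_closure)
  have hFw : ContinuousOn (fun q : ℝ × Space d => F (w q.1 q.2)) (timeInterval T ×ˢ Ω) :=
    hF.comp hwc fun q hq => hw.mem_domain q.1 hq.1 q.2 hq.2
  refine continuousOn_finsetSum _ fun j _ => ((hH.continuous_first j).comp_continuousOn hwc).mul
    ((continuousOn_const.mul (hw.continuousOn_laplacian j)).add ?_)
  exact (continuous_apply j).comp_continuousOn hFw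

/-- Differentiation in time of localized functionals of the solution. -/
theorem hasDerivAt_integral_cutoff (hw : IsClassicalSolution Ω lam D F α ρ w0 T w)
    (hΩ : IsBoundedC1Domain Ω) (hF : ContinuousOn F D) (hH : HasPartials H H₁ H₂)
    {χ : Space d → ℝ} (hχ : Continuous χ) (hsupp : tsupport χ ⊆ Ω) {t : ℝ}
    (ht : t ∈ timeInterval T) :
    HasDerivAt (fun s => ∫ x in Ω, χ x * H (w s x))
      (∫ x in Ω, χ x * ∑ j, H₁ (w t x) j *
        (lam j * Laplacian.laplacian (fun y => w t y j) x + F (w t x) j)) t := by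
  have hopen := hΩ.isOpen
  have hfin : volume Ω ≠ ∞ := hΩ.isBounded.measure_lt_top.ne
  have hcpt : HasCompactSupport χ := hΩ.isBounded.isCompact_closure.of_isClosed_subset
    (isClosed_tsupport χ) (hsupp.trans subset_closure)
  obtain ⟨K, hKnhds, hKsub, hKc⟩ :=
    local_compact_nhds ((isOpen_timeInterval T).mem_nhds ht)
  have hint := hw.continuousOn_integrand hF hH
  obtain ⟨M, hM⟩ := (hKc.prod hcpt).exists_bound_of_continuousOn
    ((hχ.comp continuous_snd).continuousOn.mul (hint.mono (prod_mono hKsub hsupp)))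
  have hslice : ∀ s ∈ timeInterval T, Continuous fun x => χ x * H (w s x) := fun s hs =>
    continuous_mul_of_tsupport_subset hopen hχ hsupp
      (hH.continuous.comp_continuousOn ((hw.continuousOn_slice hs).mono subset_closure))
  refine (hasDerivAt_integral_of_dominated_loc_of_deriv_le (μ := volume.restrict Ω)
    (F := fun s x => χ x * H (w s x)) (s := K) (bound := fun _ => max M 0)
    (F' := fun s x => χ x * ∑ j, H₁ (w s x) j *
        (lam j * Laplacian.laplacian (fun y => w s y j) x + F (w s x) j))
    hKnhds ?_ ?_ ?_ ?_ ?_ ?_).2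
  · filter_upwards [hKnhds] with s hs
    exact (hslice s (hKsub hs)).aestronglyMeasurable
  · exact ((hslice t ht).integrable_of_hasCompactSupport hcpt.mul_right).restrict
  · exact (continuous_mul_of_tsupport_subset hopen hχ hsupp
      (hint.comp (f := fun x => (t, x)) (by fun_prop) fun x hx => ⟨ht, hx⟩)).aestronglyMeasurable
  · refine Eventually.of_forall fun x s hs => ?_
    by_cases hx : x ∈ tsupport χ
    · exact (hM (s, x) ⟨hs, hx⟩).trans (le_max_left _ _)
    · rw [image_eq_zero_of_notMem_tsupport hx, zero_mul, norm_zero]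
      exact le_max_right _ _
  · exact integrableOn_const hfin
  · refine (ae_restrict_iff' hopen.measurableSet).2 (Eventually.of_forall fun x hx s hs => ?_)
    have hwd : HasDerivAt (fun s => w s x) (fun j =>
        lam j * Laplacian.laplacian (fun y => w s y j) x + F (w s x) j) s :=
      hasDerivAt_pi.2 fun j => hw.equation s (hKsub hs) x hx j
    have := ((hH.first (w s x)).comp_hasDerivAt s hwd).const_mul (χ x)
    rwa [coordForm_apply] at this

/-- The energy inequality: functionals of the solution whose second order terms, boundary fluxes and
reaction terms are controlled satisfy a Gronwall estimate. -/
theorem exists_integral_le_gronwallBound (hw : IsClassicalSolution Ω lam D F α ρ w0 T w)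
    (hΩ : IsBoundedC1Domain Ω) (hF : ContinuousOn F D) :
    ∃ A : ℝ, 0 ≤ A ∧ ∀ (H : (Fin m → ℝ) → ℝ) (H₁ : (Fin m → ℝ) → Fin m → ℝ)
      (H₂ : (Fin m → ℝ) → Fin m → Fin m → ℝ), HasPartials H H₁ H₂ →
      ∀ (S : Set (Fin m → ℝ)) (C K Cb t₁ t₂ δ : ℝ), IsClosed S → 0 < t₁ → t₁ ≤ t₂ →
      (t₂ : EReal) < T → 0 ≤ K → 0 ≤ Cb → 0 < δ →
      (∀ t ∈ Icc t₁ t₂, ∀ x ∈ Ω, w t x ∈ S) →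
      (∀ W ∈ S, ∀ ξ : Fin m → ℝ, 0 ≤ ∑ i, ∑ j, lam i * H₂ W i j * (ξ i * ξ j)) →
      (∀ W ∈ S, ∀ ξ : Fin m → ℝ, (∀ j, α * W j + (1 - α) * ξ j = ρ j) →
        ∑ j, lam j * H₁ W j * ξ j ≤ Cb) →
      (∀ W ∈ S, ∑ j, H₁ W j * F W j ≤ C * H W + K) →
      ∫ x in Ω, H (w t₂ x) ≤ gronwallBound (∫ x in Ω, H (w t₁ x)) C
        (K * volume.real Ω + A * Cb + δ) (t₂ - t₁) := by
  obtain ⟨A, hA, χ, hχ1, hχsupp, hχ0, hχle, hχlim, hχV⟩ := hΩ.exists_cutoff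
  refine ⟨A, hA, ?_⟩
  intro H H₁ H₂ hH S C K Cb t₁ t₂ δ hS ht₁ ht₁₂ ht₂ hK hCb hδ hwS hquad hbd hreact
  obtain ⟨G, hGc, hGgrad, hGbd⟩ := hw.boundary
  have hopen := hΩ.isOpen
  have hfin : volume Ω ≠ ∞ := hΩ.isBounded.measure_lt_top.ne
  have hcl : IsCompact (closure Ω) := hΩ.isBounded.isCompact_closure
  have hsub := Icc_subset_timeInterval ht₁ ht₂
  -- The flux condition is known on `S` only, and closedness of `S` carries it to the boundary
  -- values.
  have hwScl : ∀ t ∈ Icc t₁ t₂, ∀ x ∈ closure Ω, w t x ∈ S := fun t ht x hx =>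
    closure_minimal (s := w t '' Ω) (image_subset_iff.2 fun y hy => hwS t ht y hy) hS
      (((hw.continuousOn_slice (hsub ht)) x hx |>.mono subset_closure).mem_closure_image hx)
  have hwc : ContinuousOn (fun q : ℝ × Space d => w q.1 q.2) (Icc t₁ t₂ ×ˢ closure Ω) :=
    hw.continuousOn.mono (prod_mono_left hsub)
  let V : ℝ → Space d → Space d := fun t x => ∑ j, (lam j * H₁ (w t x) j) • G t x j
  have hVc : ContinuousOn (fun q : ℝ × Space d => V q.1 q.2) (Icc t₁ t₂ ×ˢ closure Ω) :=
    continuousOn_finsetSum _ fun j _ =>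
      (continuousOn_const.mul ((hH.continuous_first j).comp_continuousOn hwc)).smul
        ((hGc j).mono (prod_mono_left hsub))
  have hVbd : ∀ t ∈ Icc t₁ t₂, ∀ y ∈ frontier Ω, ∀ η, IsOutwardUnitNormal Ω y η →
      inner ℝ (V t y) η ≤ Cb := by
    intro t ht y hy η hη
    have := hbd (w t y) (hwScl t ht y (frontier_subset_closure hy)) (fun j => inner ℝ (G t y j) η)
      fun j => hGbd t (hsub ht) y hy η hη j
    simpa [V, sum_inner, inner_smul_left] using this
  have hHint : ∀ t ∈ Icc t₁ t₂, IntegrableOn (fun x => H (w t x)) Ω := fun t ht =>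
    ((hH.continuous.comp_continuousOn (hw.continuousOn_slice (hsub ht))).integrableOn_compact
      hcl).mono_set subset_closure
  have hlim : ∀ t ∈ Icc t₁ t₂, Tendsto (fun n => ∫ x in Ω, χ n x * H (w t x)) atTop
      (𝓝 (∫ x in Ω, H (w t x))) := by
    intro t ht
    refine tendsto_integral_of_dominated_convergence (fun x => ‖H (w t x)‖) (fun n => ?_)
      (hHint t ht).norm (fun n => Eventually.of_forall fun x => ?_) ?_
    · exact (hχ1 n).continuous.aestronglyMeasurable.mul (hHint t ht).aestronglyMeasurable
    · rw [norm_mul, Real.norm_of_nonneg (hχ0 n x)]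
      exact mul_le_of_le_one_left (norm_nonneg _) (hχle n x)
    · refine (ae_restrict_iff' hopen.measurableSet).2 (Eventually.of_forall fun x hx => ?_)
      simpa using (hχlim x hx).mul_const (H (w t x))
  -- The Gronwall constants are the same for all large `n`, so the estimate for the localized
  -- functionals passes to the limit. The error `δ` of the cutoffs remains in the inhomogeneity.
  refine le_of_tendsto_of_tendsto (hlim t₂ (right_mem_Icc.2 ht₁₂))
    (((continuous_gronwallBound_left C (K * volume.real Ω + A * Cb + δ) (t₂ - t₁)).tendsto _).comp
      (hlim t₁ (left_mem_Icc.2 ht₁₂))) ?_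
  filter_upwards [hχV t₁ t₂ Cb δ V hCb hδ hVc hVbd] with n hn
  have hcpt : HasCompactSupport (χ n) := hcl.of_isClosed_subset
    (isClosed_tsupport _) ((hχsupp n).trans subset_closure)
  refine le_gronwallBound_of_hasDerivAt (f := fun t => ∫ x in Ω, χ n x * H (w t x)) ht₁₂
    (fun t ht => hw.hasDerivAt_integral_cutoff hΩ hF hH (hχ1 n).continuous (hχsupp n) (hsub ht))
    fun t ht => ?_
  have hwct : ContinuousOn (w t) Ω := (hw.continuousOn_slice (hsub ht)).mono subset_closure
  have hH1c : ∀ j, ContinuousOn (fun x => H₁ (w t x) j) Ω := fun j =>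
    (hH.continuous_first j).comp_continuousOn hwct
  have hFc : ∀ j, ContinuousOn (fun x => F (w t x) j) Ω := fun j =>
    (continuous_apply j).comp_continuousOn
      (hF.comp hwct fun x hx => hw.mem_domain t (hsub ht) x hx)
  have hlapc : ∀ j, ContinuousOn (fun x => Laplacian.laplacian (fun y => w t y j) x) Ω := fun j =>
    (hw.continuousOn_laplacian j).comp (f := fun x => (t, x)) (by fun_prop)
      fun x hx => ⟨hsub ht, hx⟩
  have hi1 : Integrable (fun x => χ n x * ∑ j, lam j * H₁ (w t x) j *
      Laplacian.laplacian (fun y => w t y j) x) (volume.restrict Ω) :=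
    (integrable_mul_of_tsupport_subset hopen (hχ1 n).continuous hcpt (hχsupp n)
      (continuousOn_finsetSum _ fun j _ =>
        (continuousOn_const.mul (hH1c j)).mul (hlapc j))).restrict
  have hi2 : Integrable (fun x => χ n x * ∑ j, H₁ (w t x) j * F (w t x) j) (volume.restrict Ω) :=
    (integrable_mul_of_tsupport_subset hopen (hχ1 n).continuous hcpt (hχsupp n)
      (continuousOn_finsetSum _ fun j _ => (hH1c j).mul (hFc j))).restrict
  have hi3 : Integrable (fun x => χ n x * H (w t x)) (volume.restrict Ω) :=
    (integrable_mul_of_tsupport_subset hopen (hχ1 n).continuous hcpt (hχsupp n)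
      (hH.continuous.comp_continuousOn hwct)).restrict
  have hsplit : ∫ x in Ω, χ n x * ∑ j, H₁ (w t x) j *
        (lam j * Laplacian.laplacian (fun y => w t y j) x + F (w t x) j)
      = (∫ x in Ω, χ n x * ∑ j, lam j * H₁ (w t x) j * Laplacian.laplacian (fun y => w t y j) x)
        + ∫ x in Ω, χ n x * ∑ j, H₁ (w t x) j * F (w t x) j := by
    rw [← integral_add hi1 hi2]
    congr 1 with x
    rw [← mul_add, ← Finset.sum_add_distrib]
    congr 1
    exact Finset.sum_congr rfl fun j _ => by ring
  have hdiff := integral_laplacian_le hopen (fun j => hw.contDiffOn t (hsub ht) j)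
    (hGgrad t (hsub ht)) hH (fun x hx => hquad (w t x) (hwS t ht x hx)) (hχ1 n) hcpt (hχsupp n)
    (hχ0 n)
  have hflux := hn t ht
  have hre : ∫ x in Ω, χ n x * ∑ j, H₁ (w t x) j * F (w t x) j
      ≤ ∫ x in Ω, (C * (χ n x * H (w t x)) + K) := by
    refine setIntegral_mono_on hi2 ((hi3.const_mul C).add (integrableOn_const hfin))
      hopen.measurableSet fun x hx => ?_
    have h1 := mul_le_mul_of_nonneg_left (hreact (w t x) (hwS t ht x hx)) (hχ0 n x)
    have h2 : χ n x * K ≤ K := mul_le_of_le_one_left hK (hχle n x)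
    linarith
  rw [integral_add (hi3.const_mul C) (integrableOn_const hfin), integral_const_mul,
    setIntegral_const, smul_eq_mul] at hre
  rw [hsplit]
  simp only [V] at hflux
  linarith

end IsClassicalSolution

end TridiagRD

/-! ### Nonnegativity of the solution -/

namespace TridiagRD

variable {d m : ℕ}

/-- At `s = 0` the derivative is the limit of the derivatives nearby. The cube is the lowest power
for which the second derivative is continuous. -/
theorem hasDerivAt_max_neg_pow (k : ℕ) (s : ℝ) :
    HasDerivAt (fun s : ℝ => max (-s) 0 ^ (k + 2)) (-(k + 2) * max (-s) 0 ^ (k + 1)) s := by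
  have hne : ∀ y : ℝ, y ≠ 0 →
      HasDerivAt (fun s : ℝ => max (-s) 0 ^ (k + 2)) (-(k + 2) * max (-y) 0 ^ (k + 1)) y := by
    intro y hy
    rcases lt_or_gt_of_ne hy with h | h
    · have he : (fun s : ℝ => max (-s) 0 ^ (k + 2)) =ᶠ[𝓝 y] fun s => (-s) ^ (k + 2) := by
        filter_upwards [gt_mem_nhds h] with z hz
        rw [max_eq_left (by linarith)]
      rw [max_eq_left (by linarith)]
      refine HasDerivAt.congr_of_eventuallyEq ?_ he
      refine ((hasDerivAt_neg y).pow (k + 2)).congr_deriv ?_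
      push_cast
      ring
    · have he : (fun s : ℝ => max (-s) 0 ^ (k + 2)) =ᶠ[𝓝 y] fun _ => 0 := by
        filter_upwards [lt_mem_nhds h] with z hz
        rw [max_eq_right (by linarith), zero_pow (by omega)]
      rw [max_eq_right (by linarith), zero_pow (by omega), mul_zero]
      exact (hasDerivAt_const y 0).congr_of_eventuallyEq he
  by_cases hs : s = 0
  · subst hs
    exact hasDerivAt_of_hasDerivAt_of_ne (g := fun y => -(k + 2) * max (-y) 0 ^ (k + 1)) hne
      (by fun_prop) (by fun_prop)
  · exact hne s hs

theorem hasFDerivAt_comp_apply {f : ℝ → ℝ} {f' : ℝ} (j : Fin m) (W : Fin m → ℝ)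
    (h : HasDerivAt f f' (W j)) :
    HasFDerivAt (fun W : Fin m → ℝ => f (W j))
      (f' • ContinuousLinearMap.proj (R := ℝ) (φ := fun _ : Fin m => ℝ) j) W :=
  HasDerivAt.comp_hasFDerivAt W h (hasFDerivAt_apply j W)

/-- The sum of the cubes of the negative parts is of class `C²`. -/
theorem hasPartials_sum_neg_cube : HasPartials (m := m) (fun W => ∑ j, max (-W j) 0 ^ 3)
    (fun W j => -3 * max (-W j) 0 ^ 2) (fun W j k => if j = k then 6 * max (-W j) 0 else 0) := by
  refine ⟨fun W => ?_, fun j W => ?_, fun j k => ?_⟩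
  · unfold coordForm
    refine HasFDerivAt.fun_sum fun j _ =>
      hasFDerivAt_comp_apply (f := fun s => max (-s) 0 ^ 3) j W ?_
    exact (hasDerivAt_max_neg_pow 1 (W j)).congr_deriv (by norm_num)
  · have h : HasDerivAt (fun s : ℝ => -3 * max (-s) 0 ^ 2) (6 * max (-W j) 0) (W j) :=
      ((hasDerivAt_max_neg_pow 0 (W j)).const_mul (-3)).congr_deriv (by norm_num; ring)
    refine (hasFDerivAt_comp_apply j W h).congr_fderiv ?_
    ext v
    simp
  · split_ifs
    · fun_prop
    · exact continuous_const

theorem sq_mul_le_cube_add_cube {a b : ℝ} (ha : 0 ≤ a) (hb : 0 ≤ b) :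
    a ^ 2 * b ≤ a ^ 3 + b ^ 3 := by
  rcases le_total a b with h | h
  · have : a ^ 2 * b ≤ b ^ 2 * b := mul_le_mul_of_nonneg_right (pow_le_pow_left₀ ha h 2) hb
    nlinarith [pow_nonneg ha 3]
  · have : a ^ 2 * b ≤ a ^ 2 * a := mul_le_mul_of_nonneg_left h (sq_nonneg a)
    nlinarith [pow_nonneg hb 3]

/-- On bounded sets, quasipositive reaction terms do not increase negative parts. -/
theorem Quasipositive.exists_neg_cube_le {F : (Fin m → ℝ) → Fin m → ℝ} (hq : Quasipositive F)
    {D : Set (Fin m → ℝ)} (hD : IsClosed D) (hDconv : Convex ℝ D) (hDpos : orthant m ⊆ D)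
    (hF : ContDiffOn ℝ 1 F D) (M : ℝ) :
    ∃ C, 0 ≤ C ∧ ∀ W ∈ D ∩ Metric.closedBall 0 M,
      ∑ j, -3 * max (-W j) 0 ^ 2 * F W j ≤ C * ∑ j, max (-W j) 0 ^ 3 := by
  have hcpt : IsCompact (D ∩ Metric.closedBall 0 M) :=
    (isCompact_closedBall 0 M).inter_left hD
  -- Convexity of `D` turns `C¹` into locally Lipschitz also at the boundary of `D`.
  have hlip : LocallyLipschitzOn (D ∩ Metric.closedBall 0 M) F := by
    intro x hx
    obtain ⟨K, t, ht, hK⟩ := (hF x hx.1).exists_lipschitzOnWith hDconv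
    exact ⟨K, t, nhdsWithin_mono x inter_subset_left ht, hK⟩
  obtain ⟨L, hL⟩ := hlip.exists_lipschitzOnWith_of_compact hcpt
  refine ⟨6 * L * m, by positivity, fun W hW => ?_⟩
  set N : Fin m → ℝ := fun j => max (-W j) 0 with hN
  have hN0 : ∀ j, 0 ≤ N j := fun j => le_max_right _ _
  -- Quasipositivity is available only on the orthant, so `F W` is compared with `F` at the positive
  -- part of `W`. This costs the Lipschitz constant times the negative parts.
  set W' : Fin m → ℝ := fun j => max (W j) 0 with hW'
  have hW'pos : W' ∈ orthant m := fun j => le_max_right _ _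
  have hWM : ‖W‖ ≤ M := by simpa using hW.2
  have hW'M : ‖W'‖ ≤ M := by
    refine (pi_norm_le_iff_of_nonneg ((norm_nonneg _).trans hWM)).2 fun j => ?_
    refine le_trans ?_ ((norm_le_pi_norm W j).trans hWM)
    rw [hW', Real.norm_of_nonneg (le_max_right _ _)]
    exact max_le (le_abs_self _) (abs_nonneg _)
  have hdist : dist W W' ≤ ∑ k, N k := by
    refine (dist_pi_le_iff (Finset.sum_nonneg fun k _ => hN0 k)).2 fun j => ?_
    refine le_trans ?_ (Finset.single_le_sum (fun k _ => hN0 k) (Finset.mem_univ j))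
    rw [Real.dist_eq]
    simp only [hW', hN]
    rcases le_total (W j) 0 with h | h
    · rw [max_eq_right h, max_eq_left (by linarith), sub_zero, abs_of_nonpos h]
    · rw [max_eq_left h, sub_self, abs_zero]
      exact le_max_right _ _
  have hFW : dist (F W) (F W') ≤ L * ∑ k, N k :=
    (hL.dist_le_mul W hW W' ⟨hDpos hW'pos, by simpa using hW'M⟩).trans
      (mul_le_mul_of_nonneg_left hdist L.2)
  have hterm : ∀ j, -3 * N j ^ 2 * F W j ≤ 3 * L * ∑ k, N j ^ 2 * N k := by
    intro j
    rcases le_total 0 (W j) with h | h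
    · have h0 : N j = 0 := max_eq_right (by linarith)
      simp [h0]
    · have h0 : W' j = 0 := max_eq_right h
      have h1 := hq j W' hW'pos h0
      have h2 : |F W j - F W' j| ≤ L * ∑ k, N k := (dist_le_pi_dist (F W) (F W') j).trans hFW
      have h3 : -F W j ≤ L * ∑ k, N k := by linarith [(abs_le.1 h2).1]
      rw [← Finset.mul_sum]
      have h4 := mul_le_mul_of_nonneg_left h3 (show 0 ≤ 3 * N j ^ 2 by positivity)
      linarith
  calc ∑ j, -3 * N j ^ 2 * F W j ≤ ∑ j, 3 * L * ∑ k, N j ^ 2 * N k :=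
        Finset.sum_le_sum fun j _ => hterm j
    _ ≤ ∑ j, 3 * L * ∑ k, (N j ^ 3 + N k ^ 3) := by
        refine Finset.sum_le_sum fun j _ => mul_le_mul_of_nonneg_left
          (Finset.sum_le_sum fun k _ => sq_mul_le_cube_add_cube (hN0 j) (hN0 k)) (by positivity)
    _ = 6 * L * m * ∑ j, N j ^ 3 := by
        simp only [Finset.sum_add_distrib, Finset.sum_const, Finset.card_univ, Fintype.card_fin,
          nsmul_eq_mul, ← Finset.mul_sum]
        ring

/-- Solutions with nonnegative initial values and quasipositive reaction terms are nonnegative. -/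
theorem IsClassicalSolution.mem_orthant {Ω : Set (Space d)} {lam : Fin m → ℝ}
    {D : Set (Fin m → ℝ)} {F : (Fin m → ℝ) → Fin m → ℝ} {α : ℝ} {ρ : Fin m → ℝ}
    {w0 : Space d → Fin m → ℝ} {T : EReal} {w : ℝ → Space d → Fin m → ℝ}
    (hw : IsClassicalSolution Ω lam D F α ρ w0 T w) (hΩ : IsBoundedC1Domain Ω)
    (hlam : ∀ i, 0 < lam i) (hρ : ∀ ℓ, 0 ≤ ρ ℓ)
    (hbc : (0 < α ∧ α < 1) ∨ (α = 0 ∧ ∀ ℓ, ρ ℓ = 0) ∨ (α = 1 ∧ ∀ ℓ, ρ ℓ = 0))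
    (hD : IsClosed D) (hDconv : Convex ℝ D) (hDpos : orthant m ⊆ D) (hF : ContDiffOn ℝ 1 F D)
    (hFpos : Quasipositive F) (hw0 : ∀ ℓ, MemLp (fun x => w0 x ℓ) ∞ (volume.restrict Ω))
    (hw0pos : ∀ᵐ x ∂(volume.restrict Ω), ∀ ℓ, 0 ≤ w0 x ℓ)
    {t : ℝ} (ht : t ∈ timeInterval T) {x : Space d} (hx : x ∈ Ω) : w t x ∈ orthant m := by
  obtain ⟨M₀, hM₀⟩ := hw.locallyBounded t ht.2
  set M := max M₀ 0 with hM
  have hM0 : 0 ≤ M := le_max_right _ _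
  have hbound : ∀ s, 0 < s → s ≤ t → ∀ y ∈ Ω, ∀ ℓ, |w s y ℓ| ≤ M := fun s hs hst y hy ℓ =>
    (hM₀ s hs hst y hy ℓ).trans (le_max_left _ _)
  obtain ⟨C, hC0, hC⟩ := hFpos.exists_neg_cube_le hD hDconv hDpos hF M
  obtain ⟨A, hA, henergy⟩ := hw.exists_integral_le_gronwallBound hΩ hF.continuousOn
  set H : (Fin m → ℝ) → ℝ := fun W => ∑ j, max (-W j) 0 ^ 3 with hH
  have hH0 : ∀ W, 0 ≤ H W := fun W =>
    Finset.sum_nonneg fun j _ => pow_nonneg (le_max_right _ _) 3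
  have hHc : Continuous H := hasPartials_sum_neg_cube.continuous
  have hopen := hΩ.isOpen
  have : IsFiniteMeasure (volume.restrict Ω) :=
    isFiniteMeasure_restrict.2 hΩ.isBounded.measure_lt_top.ne
  have hwcont : ∀ s ∈ timeInterval T, ContinuousOn (w s) (closure Ω) := fun s hs =>
    hw.continuousOn_slice hs
  have hcl : IsCompact (closure Ω) := hΩ.isBounded.isCompact_closure
  have hgron : ∀ δ > 0, ∀ s, 0 < s → s ≤ t →
      ∫ x in Ω, H (w t x) ≤ gronwallBound (∫ x in Ω, H (w s x)) C δ t := by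
    intro δ hδ s hs hst
    have h1 := henergy H _ _ hasPartials_sum_neg_cube (D ∩ Metric.closedBall 0 M) C 0 0 s t δ
      (hD.inter Metric.isClosed_closedBall) hs hst ht.2 le_rfl le_rfl hδ ?_ ?_ ?_ ?_
    · rw [zero_mul, mul_zero, zero_add, zero_add] at h1
      exact h1.trans (gronwallBound_mono (integral_nonneg fun x => hH0 _) hδ.le hC0 (by linarith))
    · intro r hr y hy
      have hrT := Icc_subset_timeInterval hs ht.2 hr
      refine ⟨hw.mem_domain r hrT y hy, ?_⟩
      rw [mem_closedBall_zero_iff, pi_norm_le_iff_of_nonneg hM0]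
      exact fun ℓ => hbound r hrT.1 hr.2 y hy ℓ
    · intro W _ ξ
      refine Finset.sum_nonneg fun i _ => ?_
      simp only [mul_ite, ite_mul, mul_zero, zero_mul, Finset.sum_ite_eq, Finset.mem_univ, if_true]
      exact mul_nonneg (mul_nonneg (hlam i).le (mul_nonneg (by norm_num) (le_max_right _ _)))
        (mul_self_nonneg _)
    -- Where `W j < 0`, the boundary condition with `ρ j ≥ 0` forces `ξ j ≥ 0`, or is contradictory
    -- in the Dirichlet case; so the flux is at most `0`.
    · intro W _ ξ hξ
      refine Finset.sum_nonpos fun j _ => ?_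
      rcases le_or_gt 0 (W j) with h | h
      · simp [max_eq_right (neg_nonpos.2 h)]
      · have hξj : 0 ≤ ξ j := by
          have h2 := hξ j
          have h3 := hρ j
          rcases hbc with ⟨h0, h1⟩ | ⟨rfl, -⟩ | ⟨rfl, h0⟩
          · by_contra hneg
            nlinarith [mul_pos h0 (neg_pos.2 h), mul_pos (sub_pos.2 h1) (neg_pos.2 (not_le.1 hneg))]
          · linarith
          · rw [h0] at h2
            linarith
        have h4 : 0 ≤ lam j * max (-W j) 0 ^ 2 * ξ j :=
          mul_nonneg (mul_nonneg (hlam j).le (sq_nonneg _)) hξj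
        linarith
    · intro W hW
      rw [add_zero]
      exact hC W hW
  -- As `w0 ≥ 0`, the negative part of `w` is at most `|w - w0|`; the two other factors of the cube
  -- are bounded by `M`.
  have hsmall : Tendsto (fun s => ∫ x in Ω, H (w s x)) (𝓝[>] 0) (𝓝 0) := by
    have hlim : Tendsto (fun s => ∑ ℓ, M ^ 2 *
        (eLpNorm (fun x => w s x ℓ - w0 x ℓ) 1 (volume.restrict Ω)).toReal) (𝓝[>] 0) (𝓝 0) := by
      have h := tendsto_finsetSum Finset.univ fun ℓ _ =>
        ((ENNReal.tendsto_toReal ENNReal.zero_ne_top).comp (hw.initial ℓ)).const_mul (M ^ 2)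
      simpa using h
    refine tendsto_of_tendsto_of_tendsto_of_le_of_le' tendsto_const_nhds hlim
      (Eventually.of_forall fun s => integral_nonneg fun x => hH0 _) ?_
    filter_upwards [Ioc_mem_nhdsGT ht.1] with s hs
    have hsT : s ∈ timeInterval T := ⟨hs.1, lt_of_le_of_lt (EReal.coe_le_coe_iff.2 hs.2) ht.2⟩
    have hwint : ∀ ℓ, Integrable (fun x => w s x ℓ - w0 x ℓ) (volume.restrict Ω) := fun ℓ =>
      ((((continuous_apply ℓ).comp_continuousOn (hwcont s hsT)).integrableOn_compact
        hcl).mono_set subset_closure).sub ((hw0 ℓ).integrable le_top)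
    have hHint : IntegrableOn (fun x => H (w s x)) Ω :=
      ((hHc.comp_continuousOn (hwcont s hsT)).integrableOn_compact hcl).mono_set subset_closure
    have hnorm : ∀ ℓ, (eLpNorm (fun x => w s x ℓ - w0 x ℓ) 1 (volume.restrict Ω)).toReal
        = ∫ x in Ω, ‖w s x ℓ - w0 x ℓ‖ := fun ℓ => by
      rw [eLpNorm_one_eq_lintegral_enorm, integral_norm_eq_lintegral_enorm
        (hwint ℓ).aestronglyMeasurable]
    simp_rw [hnorm, ← integral_const_mul]
    rw [← integral_finsetSum _ fun ℓ _ => ((hwint ℓ).norm.const_mul (M ^ 2))]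
    refine integral_mono_ae hHint
      (integrable_finsetSum _ fun ℓ _ => ((hwint ℓ).norm.const_mul (M ^ 2))) ?_
    filter_upwards [hw0pos, ae_restrict_mem hopen.measurableSet] with y hy hyΩ
    refine Finset.sum_le_sum fun ℓ _ => ?_
    have h1 : max (-w s y ℓ) 0 ≤ M :=
      max_le ((neg_le_abs _).trans (hbound s hs.1 hs.2 y hyΩ ℓ)) hM0
    have h2 : max (-w s y ℓ) 0 ≤ ‖w s y ℓ - w0 y ℓ‖ := by
      refine max_le ?_ (norm_nonneg _)
      rw [Real.norm_eq_abs]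
      linarith [neg_le_abs (w s y ℓ - w0 y ℓ), hy ℓ]
    rw [pow_succ]
    exact mul_le_mul (pow_le_pow_left₀ (le_max_right _ _) h1 2) h2 (le_max_right _ _)
      (sq_nonneg M)
  have hle : ∫ x in Ω, H (w t x) ≤ 0 := by
    have h1 : ∀ δ > 0, ∫ x in Ω, H (w t x) ≤ gronwallBound 0 C δ t := fun δ hδ => by
      refine ge_of_tendsto (((continuous_gronwallBound_left C δ t).tendsto 0).comp hsmall) ?_
      filter_upwards [Ioc_mem_nhdsGT ht.1] with s hs using hgron δ hδ s hs.1 hs.2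
    have h2 : Tendsto (fun δ => gronwallBound 0 C δ t) (𝓝[>] 0) (𝓝 0) := by
      have := ((gronwallBound_continuous_ε 0 C t).tendsto 0).mono_left
        (nhdsWithin_le_nhds (s := Ioi 0))
      rwa [gronwallBound_ε0_δ0] at this
    refine ge_of_tendsto h2 ?_
    filter_upwards [self_mem_nhdsWithin] with δ hδ using h1 δ hδ
  have hHw : ContinuousOn (fun x => H (w t x)) Ω :=
    hHc.comp_continuousOn ((hwcont t ht).mono subset_closure)
  have hHint : IntegrableOn (fun x => H (w t x)) Ω :=
    ((hHc.comp_continuousOn (hwcont t ht)).integrableOn_compact hcl).mono_set subset_closure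
  have hae := (integral_eq_zero_iff_of_nonneg (fun x => hH0 (w t x)) hHint).1
    (le_antisymm hle (integral_nonneg fun x => hH0 _))
  have hzero := Measure.eqOn_open_of_ae_eq hae hopen hHw continuousOn_const hx
  intro j
  have h3 : max (-w t x j) 0 ^ 3 = 0 :=
    (Finset.sum_eq_zero_iff_of_nonneg fun j _ => pow_nonneg (le_max_right _ _) 3).1 hzero j
      (Finset.mem_univ j)
  have h4 := (pow_eq_zero_iff (three_ne_zero)).1 h3
  linarith [le_max_left (-w t x j) 0]

end TridiagRD

/-! ### Moment bounds up to the final time -/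

namespace TridiagRD

variable {d m : ℕ}

theorem hasPartials_lyap (θ : Fin m → ℝ) (k : ℕ) : HasPartials (lyap θ (k + 2) 0)
    (fun W j => (k + 2 : ℝ) * lyap θ (k + 1) (Pi.single j 1) W)
    (fun W i j => (k + 2 : ℝ) * ((k + 1 : ℝ) * lyap θ k (Pi.single i 1 + Pi.single j 1) W)) := by
  refine ⟨fun W => ?_, fun j W => ?_, fun i j => ?_⟩
  · refine (hasFDerivAt_lyap_succ θ (k + 1) 0 W).congr_fderiv ?_
    congr 1
    ext j
    rw [zero_add]
    push_cast
    ring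
  · refine ((hasFDerivAt_lyap_succ θ k (Pi.single j 1) W).const_mul (k + 2 : ℝ)).congr_fderiv ?_
    ext v
    simp [Finset.mul_sum, mul_assoc]
  · exact continuous_const.mul (continuous_const.mul (continuous_lyap θ k _))

/-- A bound of all moments of nonnegative solutions, uniform up to the final time. -/
theorem IsClassicalSolution.exists_integral_sum_pow_le {Ω : Set (Space d)} {lam : Fin m → ℝ}
    {D : Set (Fin m → ℝ)} {F : (Fin m → ℝ) → Fin m → ℝ} {α : ℝ} {ρ : Fin m → ℝ}
    {w0 : Space d → Fin m → ℝ} {T : EReal} {w : ℝ → Space d → Fin m → ℝ}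
    (hw : IsClassicalSolution Ω lam D F α ρ w0 T w) (hΩ : IsBoundedC1Domain Ω)
    (hlam : ∀ i, 0 < lam i) (hρ : ∀ ℓ, 0 ≤ ρ ℓ)
    (hbc : (0 < α ∧ α < 1) ∨ (α = 0 ∧ ∀ ℓ, ρ ℓ = 0) ∨ (α = 1 ∧ ∀ ℓ, ρ ℓ = 0))
    (hF : ContinuousOn F D) (hFcontrol : LinearControl F)
    (hpos : ∀ t ∈ timeInterval T, ∀ x ∈ Ω, w t x ∈ orthant m)
    {Tstar : ℝ} (hT0 : 0 < Tstar) (hT : (Tstar : EReal) ≤ T) (k : ℕ) :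
    ∃ B : ℝ, ∀ t ∈ Ioo 0 Tstar, ∫ x in Ω, (∑ ℓ, w t x ℓ) ^ (k + 2) ≤ B := by
  obtain ⟨Dbar, hDbar, hcontrol⟩ := hFcontrol
  obtain ⟨Θ₀, hΘ₀, hquad⟩ := exists_weight_quadratic lam hlam
  -- One weight has to serve both the quadratic form and linear control.
  set Θ := Θ₀ + ∑ ℓ, Dbar ℓ with hΘ
  have hDsum : 0 ≤ ∑ ℓ, Dbar ℓ := Finset.sum_nonneg fun ℓ _ => (hDbar ℓ).le
  have hΘ1 : 1 ≤ Θ := by linarith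
  have hΘD : ∀ ℓ, Dbar ℓ ≤ Θ := fun ℓ => by
    linarith [Finset.single_le_sum (fun ℓ _ => (hDbar ℓ).le) (Finset.mem_univ ℓ)]
  set θ := weight m Θ with hθ
  have hθ1 : ∀ i, 1 ≤ θ i := one_le_weight hΘ1
  obtain ⟨C, hC0, hC⟩ := exists_lyap_reaction_le hΘ1 hΘD hcontrol (k + 1) 0
  obtain ⟨Cb, hCb0, hCb⟩ := exists_lyap_boundary_le hlam hθ1 hρ hbc k.succ_ne_zero
  obtain ⟨A, hA, henergy⟩ := hw.exists_integral_le_gronwallBound hΩ hF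
  set H := lyap θ (k + 2) 0 with hH
  have hHc : Continuous H := continuous_lyap θ _ _
  set C' := (k + 2 : ℝ) * (C * 2 ^ (k + 2)) with hC'
  have hC'0 : 0 ≤ C' := by positivity
  have hcl : IsCompact (closure Ω) := hΩ.isBounded.isCompact_closure
  have htime : ∀ t ∈ Ioo 0 Tstar, t ∈ timeInterval T := fun t ht =>
    ⟨ht.1, (EReal.coe_lt_coe_iff.2 ht.2).trans_le hT⟩
  -- Until `Tstar / 2` local boundedness gives the estimate; from there on Gronwall gives it, with
  -- constants independent of `t`, although `w` may be unbounded as `t → Tstar`.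
  have hhalf : Tstar / 2 ∈ Ioo 0 Tstar := ⟨by linarith, by linarith⟩
  obtain ⟨M, hM⟩ := hw.locallyBounded (Tstar / 2) (htime _ hhalf).2
  have hsumint : ∀ t ∈ Ioo 0 Tstar, IntegrableOn (fun x => (∑ ℓ, w t x ℓ) ^ (k + 2)) Ω :=
    fun t ht => (ContinuousOn.integrableOn_compact hcl ((continuousOn_finsetSum _ fun ℓ _ =>
      (continuous_apply ℓ).comp_continuousOn (hw.continuousOn_slice (htime t ht))).pow
        (k + 2))).mono_set subset_closure
  have hHint : ∀ t ∈ Ioo 0 Tstar, IntegrableOn (fun x => H (w t x)) Ω := fun t ht =>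
    ((hHc.comp_continuousOn (hw.continuousOn_slice (htime t ht))).integrableOn_compact
      hcl).mono_set subset_closure
  set ε := C' * volume.real Ω + A * ((k + 2 : ℝ) * Cb) + 1 with hε
  have hε0 : 0 ≤ ε := by positivity
  have hI0 : 0 ≤ ∫ x in Ω, H (w (Tstar / 2) x) :=
    setIntegral_nonneg hΩ.isOpen.measurableSet fun x hx =>
      lyap_nonneg hθ1 _ _ (hpos _ (htime _ hhalf) x hx)
  refine ⟨max (gronwallBound (∫ x in Ω, H (w (Tstar / 2) x)) C' ε Tstar)
    ((m * M) ^ (k + 2) * volume.real Ω), fun t ht => ?_⟩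
  rcases le_total t (Tstar / 2) with hle | hle
  · refine le_trans ?_ (le_max_right _ _)
    calc ∫ x in Ω, (∑ ℓ, w t x ℓ) ^ (k + 2) ≤ ∫ _ in Ω, (m * M) ^ (k + 2) := by
          refine setIntegral_mono_on (hsumint t ht)
            (integrableOn_const hΩ.isBounded.measure_lt_top.ne) hΩ.isOpen.measurableSet
            fun x hx => ?_
          refine pow_le_pow_left₀ (sum_nonneg_of_mem_orthant (hpos t (htime t ht) x hx)) ?_ _
          calc ∑ ℓ, w t x ℓ ≤ ∑ _ℓ : Fin m, M :=
                Finset.sum_le_sum fun ℓ _ => (le_abs_self _).trans (hM t ht.1 hle x hx ℓ)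
            _ = m * M := by simp
      _ = _ := by rw [setIntegral_const, smul_eq_mul, mul_comm]
  · refine le_trans ?_ (le_max_left _ _)
    have h1 : ∫ x in Ω, (∑ ℓ, w t x ℓ) ^ (k + 2) ≤ ∫ x in Ω, H (w t x) :=
      setIntegral_mono_on (hsumint t ht) (hHint t ht) hΩ.isOpen.measurableSet fun x hx =>
        sum_pow_le_lyap hθ1 _ _ (hpos t (htime t ht) x hx)
    have h2 := henergy H _ _ (hasPartials_lyap θ k) (orthant m) C' C' ((k + 2 : ℝ) * Cb)
      (Tstar / 2) t 1 ?_ hhalf.1 hle (htime t ht).2 hC'0 (by positivity) one_pos ?_ ?_ ?_ ?_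
    · exact h1.trans (h2.trans (gronwallBound_mono hI0 hε0 hC'0 (by linarith [ht.2, hhalf.1])))
    · have : orthant m = ⋂ ℓ, {W | 0 ≤ W ℓ} := by ext W; simp [orthant]
      rw [this]
      exact isClosed_iInter fun ℓ => isClosed_le continuous_const (continuous_apply ℓ)
    · exact fun s hs x hx => hpos s (Icc_subset_timeInterval hhalf.1 (htime t ht).2 hs) x hx
    · intro W hW ξ
      have h3 := lyap_quadratic_nonneg (zero_le_one.trans hΘ1)
        (hquad Θ (by linarith)) k 0 hW ξ
      have h4 : 0 ≤ (k + 2 : ℝ) * (k + 1) := by positivity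
      refine (mul_nonneg h4 h3).trans_eq ?_
      simp_rw [Finset.mul_sum, zero_add]
      refine Finset.sum_congr rfl fun i _ => Finset.sum_congr rfl fun j _ => ?_
      ring
    · intro W hW ξ hξ
      have h3 := mul_le_mul_of_nonneg_left (hCb W hW ξ hξ) (show (0 : ℝ) ≤ k + 2 by positivity)
      refine Eq.trans_le ?_ h3
      rw [Finset.mul_sum]
      exact Finset.sum_congr rfl fun j _ => by ring
    · intro W hW
      have hs := sum_nonneg_of_mem_orthant hW
      have h3 := hC W hW
      simp only [zero_add] at h3
      have h4 : (1 + ∑ ℓ, W ℓ) ^ (k + 1 + 1) ≤ 2 ^ (k + 2) * (1 + H W) :=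
        (one_add_pow_le_two_pow_mul hs (k + 2)).trans
          (mul_le_mul_of_nonneg_left (by linarith [sum_pow_le_lyap hθ1 (k + 2) 0 hW])
            (by positivity))
      have h5 := h3.trans (mul_le_mul_of_nonneg_left h4 hC0)
      have h6 := mul_le_mul_of_nonneg_left h5 (show (0 : ℝ) ≤ k + 2 by positivity)
      calc ∑ j, (k + 2 : ℝ) * lyap θ (k + 1) (Pi.single j 1) W * F W j
          = (k + 2 : ℝ) * ∑ j, lyap θ (k + 1) (Pi.single j 1) W * F W j := by
            rw [Finset.mul_sum]
            exact Finset.sum_congr rfl fun j _ => by ring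
        _ ≤ _ := h6
        _ = C' * H W + C' := by rw [hC']; ring

/-! ### From moments to the Bochner space -/

/-- A continuous function whose values have bounded `L^p` norms is in `L^∞(0, T; L^p)`. -/
theorem memLinftyLp_of_eLpNorm_le {Ω : Set (Space d)} (hΩ : Bornology.IsBounded Ω)
    (hopen : IsOpen Ω) {T : ℝ} {p : ℝ≥0∞} [Fact (1 ≤ p)] {u : ℝ → Space d → ℝ}
    (hu : ContinuousOn (fun q : ℝ × Space d => u q.1 q.2) (Ioo 0 T ×ˢ closure Ω)) {B : ℝ≥0∞}
    (hB : B ≠ ∞) (hbound : ∀ t ∈ Ioo 0 T, eLpNorm (u t) p (volume.restrict Ω) ≤ B) :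
    MemLinftyLp T Ω p u := by
  have : IsFiniteMeasure (volume.restrict Ω) := isFiniteMeasure_restrict.2 hΩ.measure_lt_top.ne
  have hslice : ∀ t ∈ Ioo 0 T, ContinuousOn (u t) (closure Ω) := fun t ht =>
    hu.comp (f := fun x => (t, x)) (by fun_prop) fun _ hx => ⟨ht, hx⟩
  have hmem : ∀ t : Ioo 0 T, MemLp (u t) p (volume.restrict Ω) := fun t =>
    ⟨((hslice t t.2).mono subset_closure).aestronglyMeasurable hopen.measurableSet,
      (hbound t t.2).trans_lt hB.lt_top⟩
  classical
  let v : ℝ → Lp ℝ p (volume.restrict Ω) := fun t =>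
    if ht : t ∈ Ioo 0 T then (hmem ⟨t, ht⟩).toLp (u t) else 0
  have hv : ∀ t : Ioo 0 T, v t = (hmem t).toLp (u t) := fun t => dif_pos t.2
  -- Continuity in time yields strong measurability of `v`. It holds because `u s → u t` uniformly
  -- on the compact closure of `Ω`, which has finite measure.
  have hcont : ContinuousOn v (Ioo 0 T) := by
    rw [continuousOn_iff_continuous_domRestrict]
    have : (Ioo 0 T).domRestrict v = fun t : Ioo 0 T => (hmem t).toLp (u t) := funext hv
    rw [this, continuous_iff_continuousAt]
    intro t
    rw [ContinuousAt, Lp.tendsto_Lp_iff_tendsto_eLpNorm'' (fun s : Ioo 0 T => u s) hmem]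
    have hle : ∀ ε > 0, ∀ᶠ s : Ioo 0 T in 𝓝 t, eLpNorm (u s - u t) p (volume.restrict Ω) ≤
        volume.restrict Ω univ ^ p.toReal⁻¹ * ENNReal.ofReal ε := by
      intro ε hε
      obtain ⟨V, hV, hVu⟩ := hΩ.isCompact_closure.mem_uniformity_of_prod (f := u) hu t.2
        (Metric.dist_mem_uniformity hε)
      rw [isOpen_Ioo.nhdsWithin_eq t.2] at hV
      filter_upwards [continuous_subtype_val.continuousAt.preimage_mem_nhds hV] with s hs
      refine eLpNorm_le_of_ae_bound ?_
      filter_upwards [ae_restrict_mem hopen.measurableSet] with x hx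
      have := hVu s hs x (subset_closure hx)
      rw [Pi.sub_apply, ← dist_eq_norm]
      exact le_of_lt this
    have hK : volume.restrict Ω univ ^ p.toReal⁻¹ ≠ ∞ :=
      ENNReal.rpow_ne_top_of_nonneg (inv_nonneg.2 ENNReal.toReal_nonneg) (measure_ne_top _ _)
    rw [ENNReal.tendsto_nhds_zero]
    intro η hη
    have hlim : Tendsto (fun ε : ℝ => volume.restrict Ω univ ^ p.toReal⁻¹ * ENNReal.ofReal ε)
        (𝓝[>] 0) (𝓝 0) := by
      have h := ENNReal.Tendsto.const_mul (a := volume.restrict Ω univ ^ p.toReal⁻¹)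
        ((ENNReal.continuous_ofReal.tendsto 0).mono_left (nhdsWithin_le_nhds (s := Ioi 0)))
        (Or.inr hK)
      simpa using h
    obtain ⟨ε, hε1, hε2⟩ :=
      ((hlim.eventually (gt_mem_nhds hη)).and self_mem_nhdsWithin).exists
    filter_upwards [hle ε hε2] with s hs using hs.trans hε1.le
  refine ⟨v, memLp_top_of_bound (hcont.aestronglyMeasurable measurableSet_Ioo) B.toReal ?_, ?_⟩
  · filter_upwards [ae_restrict_mem measurableSet_Ioo] with t ht
    rw [hv ⟨t, ht⟩, Lp.norm_toLp]
    exact ENNReal.toReal_mono hB (hbound t ht)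
  · filter_upwards [ae_restrict_mem measurableSet_Ioo] with t ht
    rw [hv ⟨t, ht⟩]
    exact (hmem ⟨t, ht⟩).coeFn_toLp

/-- Hölder on a finite measure space passes from the integer exponent `n` down to `p`. -/
theorem eLpNorm_le_of_integral_pow_le {X : Type*} [MeasurableSpace X] {μ : Measure X}
    [IsFiniteMeasure μ] {f g : X → ℝ} (hf : AEStronglyMeasurable f μ) {n : ℕ} (hn : n ≠ 0)
    (hfg : ∀ᵐ x ∂μ, |f x| ≤ g x) (hg : Integrable (fun x => g x ^ n) μ) {B : ℝ}
    (hB : ∫ x, g x ^ n ∂μ ≤ B) {p : ℝ≥0∞} (hpn : p ≤ n) :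
    eLpNorm f p μ ≤ ENNReal.ofReal B ^ (1 / (n : ℝ)) *
      μ univ ^ (1 / p.toReal - 1 / (n : ℝ)) := by
  have h1 := eLpNorm_le_eLpNorm_mul_rpow_measure_univ hpn hf
  rw [ENNReal.toReal_natCast] at h1
  refine h1.trans (mul_le_mul_left ?_ _)
  rw [eLpNorm_eq_lintegral_rpow_enorm_toReal (by exact_mod_cast hn) (ENNReal.natCast_ne_top n),
    ENNReal.toReal_natCast]
  refine ENNReal.rpow_le_rpow ?_ (by positivity)
  have hg0 : 0 ≤ᵐ[μ] fun x => g x ^ n := by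
    filter_upwards [hfg] with x hx using pow_nonneg ((abs_nonneg _).trans hx) n
  calc ∫⁻ x, ‖f x‖ₑ ^ (n : ℝ) ∂μ ≤ ∫⁻ x, ENNReal.ofReal (g x ^ n) ∂μ := by
        refine lintegral_mono_ae ?_
        filter_upwards [hfg] with x hx
        rw [ENNReal.rpow_natCast, ENNReal.ofReal_pow ((abs_nonneg _).trans hx),
          Real.enorm_eq_ofReal_abs]
        exact pow_le_pow_left₀ zero_le (ENNReal.ofReal_le_ofReal hx) n
    _ = ENNReal.ofReal (∫ x, g x ^ n ∂μ) := (ofReal_integral_eq_lintegral_ofReal hg hg0).symm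
    _ ≤ ENNReal.ofReal B := ENNReal.ofReal_le_ofReal hB

end TridiagRD

end

theorem corollary1
    {d m : ℕ} (hd : 1 ≤ d) (hm : 2 ≤ m)
    (Ω : Set (TridiagRD.Space d)) (hΩ : TridiagRD.IsBoundedC1Domain Ω)
    (a b : ℝ) (ha : 0 < a) (hb : 0 < b)
    (hab : 2 * b * Real.cos (Real.pi / ((m : ℝ) + 1)) < a)
    (α : ℝ) (ρ : Fin m → ℝ) (hρ : ∀ ℓ, 0 ≤ ρ ℓ)
    (hbc : (0 < α ∧ α < 1) ∨ (α = 0 ∧ ∀ ℓ, ρ ℓ = 0) ∨ (α = 1 ∧ ∀ ℓ, ρ ℓ = 0))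
    (D : Set (Fin m → ℝ)) (hD : IsClosed D) (hDconv : Convex ℝ D)
    (hDpos : TridiagRD.orthant m ⊆ D)
    (F : (Fin m → ℝ) → Fin m → ℝ) (hF : ContDiffOn ℝ 1 F D)
    (hFpos : TridiagRD.Quasipositive F)
    (hFgrowth : TridiagRD.PolynomialGrowth F)
    (hFcontrol : TridiagRD.LinearControl F)
    (w0 : TridiagRD.Space d → Fin m → ℝ)
    (hw0 : ∀ ℓ, MemLp (fun x => w0 x ℓ) ∞ (volume.restrict Ω))
    (hw0pos : ∀ᵐ x ∂(volume.restrict Ω), ∀ ℓ, 0 ≤ w0 x ℓ)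
    (Tmax : EReal) (w : ℝ → TridiagRD.Space d → Fin m → ℝ)
    (hw : TridiagRD.IsClassicalSolution Ω (TridiagRD.diffusionEigenvalue m a b) D F α ρ w0 Tmax w)
    (Tstar : ℝ) (hTstar : 0 < Tstar) (hTstar_le : (Tstar : EReal) ≤ Tmax) :
    ∀ (p : ℝ≥0∞) [Fact (1 ≤ p)], p ≠ ∞ →
      ∀ ℓ, TridiagRD.MemLinftyLp Tstar Ω p (fun t x => w t x ℓ) := by
  intro p hp1 hp ℓ
  have hlam := TridiagRD.diffusionEigenvalue_pos (m := m) hb hab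
  have hpos : ∀ t ∈ TridiagRD.timeInterval Tmax, ∀ x ∈ Ω, w t x ∈ TridiagRD.orthant m :=
    fun t ht x hx => hw.mem_orthant hΩ hlam hρ hbc hD hDconv hDpos hF hFpos hw0 hw0pos ht hx
  -- The moment of order `k + 2` is used, as the Lyapunov polynomials are differentiated twice.
  obtain ⟨k, hk⟩ := exists_nat_ge p.toReal
  have hpk : p ≤ ((k + 2 : ℕ) : ℝ≥0∞) := by
    rw [← ENNReal.ofReal_toReal hp, ← ENNReal.ofReal_natCast]
    refine ENNReal.ofReal_le_ofReal (hk.trans ?_)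
    exact_mod_cast Nat.le_add_right k 2
  obtain ⟨B, hB⟩ := hw.exists_integral_sum_pow_le hΩ hlam hρ hbc hF.continuousOn hFcontrol hpos
    hTstar hTstar_le k
  have : IsFiniteMeasure (volume.restrict Ω) :=
    isFiniteMeasure_restrict.2 hΩ.isBounded.measure_lt_top.ne
  have htime : Ioo 0 Tstar ⊆ TridiagRD.timeInterval Tmax := fun t ht =>
    ⟨ht.1, (EReal.coe_lt_coe_iff.2 ht.2).trans_le hTstar_le⟩
  have hslice : ∀ t ∈ Ioo 0 Tstar, ∀ j, ContinuousOn (fun x => w t x j) (closure Ω) :=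
    fun t ht j => (continuous_apply j).comp_continuousOn (hw.continuousOn_slice (htime ht))
  have hp0 : 0 < p.toReal :=
    ENNReal.toReal_pos (zero_lt_one.trans_le hp1.out).ne' hp
  refine TridiagRD.memLinftyLp_of_eLpNorm_le hΩ.isBounded hΩ.isOpen
    ((continuous_apply ℓ).comp_continuousOn (hw.continuousOn.mono (prod_mono_left htime)))
    (B := ENNReal.ofReal B ^ (1 / ((k + 2 : ℕ) : ℝ)) *
      volume.restrict Ω univ ^ (1 / p.toReal - 1 / ((k + 2 : ℕ) : ℝ))) ?_ fun t ht => ?_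
  · refine ENNReal.mul_ne_top (ENNReal.rpow_ne_top_of_nonneg (by positivity) ENNReal.ofReal_ne_top)
      (ENNReal.rpow_ne_top_of_nonneg ?_ (measure_ne_top _ _))
    rw [sub_nonneg]
    refine one_div_le_one_div_of_le hp0 (hk.trans ?_)
    exact_mod_cast Nat.le_add_right k 2
  · refine TridiagRD.eLpNorm_le_of_integral_pow_le
      (((hslice t ht ℓ).mono subset_closure).aestronglyMeasurable hΩ.isOpen.measurableSet)
      (by omega) (g := fun x => ∑ j, w t x j) ?_ ?_ (hB t ht) hpk
    · filter_upwards [ae_restrict_mem hΩ.isOpen.measurableSet] with x hx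
      have h := hpos t (htime ht) x hx
      rw [abs_of_nonneg (h ℓ)]
      exact Finset.single_le_sum (fun j _ => h j) (Finset.mem_univ ℓ)
    · exact (ContinuousOn.integrableOn_compact hΩ.isBounded.isCompact_closure
        ((continuousOn_finsetSum _ fun j _ => hslice t ht j).pow (k + 2))).mono_set subset_closure
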